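/- **Setting.** Let $\mathbb C$ be a small category and $\mathcal E=\mathrm{Psh}(\mathbb C)$. Let $\mathcal E^\to$ be the category of arrows and commutative squares of $\mathcal E$, and $\mathcal E^\to_{\mathrm{cart}}$ its subcategory of all arrows and pullback squares. Let $I\otimes(-)\colon\mathcal E\to\mathcal E$ be a functorial cylinder, with endpoint inclusions $\delta^0\otimes(-),\delta^1\otimes(-)\colon \mathrm{Id}\to I\otimes(-)$. Suppose that it has contractions, i.e. a natural transformation $\varepsilon\otimes(-)\colon I\otimes(-)\to\mathrm{Id}$ that is a common retraction of the endpoint inclusions, and connections, i.e. natural transformations $c^k\otimes(-)\colon I\otimes I\otimes(-)\to I\otimes(-)$ for $k\in\{0,1\}$ with $$c^k\circ(\delta^k\otimes I\otimes X)=c^k\circ(I\otimes\delta^k\otimes X)=(\delta^k\otimes X)\circ(\varepsilon\otimes X),\qquad c^k\circ(\delta^{1-k}\otimes I\otimes X)=c^k\circ(I\otimes\delta^{1-k}\otimes X)=\mathrm{id}_{I\otimes X}.$$ Suppose also that $I\otimes(-)$ has a right adjoint, and that * (C1) $I\otimes(-)$ preserves pullback squares; * (C2) the natural transformations $\delta^k\otimes(-)$,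 $k\in\{0,1\}$, are cartesian, i.e. all their naturality squares are pullbacks. For $i\colon A\to B$ and $k\in\{0,1\}$, the Leibniz product $\delta^k\mathbin{\hat\otimes} i\colon (I\otimes A)+_A B\to I\otimes B$ is the map induced by $I\otimes i$ and $\delta^k\otimes B$ from the pushout of $\delta^k\otimes A$ and $i$. Let $\mathcal M$ be a full subcategory of $\mathcal E^\to_{\mathrm{cart}}$ such that * (M1) all elements of $\mathcal M$ are monomorphisms; * (M2) for every $X\in\mathcal E$ the map $\bot_X\colon 0\to X$ is in $\mathcal M$; * (M3) the elements of $\mathcal M$ are closed under pullback; * (M4) the elements of $\mathcal M$ are closed under $\delta^k\mathbin{\hat\otimes}(-)$ for $k\in\{0,1\}$. **Definitions.** For a functor $u\colon\mathcal I\to\mathcal E^\to$, $u_i\colon A_i\to B_i$, the category $\mathcal I^{\pitchfork}$ has as objects the maps $f\colon X\to Y$ of $\mathcal E$ equipped with a diagonal filler $\phi(i,s,t)\colon B_i\to X$ for each $i\in\mathcal I$ and each commuting square $(s,t)\colon u_i\to f$, such that $\phi(j,s,t)\circ b=\phi(i,s\circ a,t\circ b)$ whenever $(a,b)\colon u_i\to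 u_j$ is the image under $u$ of a map $i\to j$; its morphisms are the squares that commute with the chosen fillers. An algebraic weak factorization system (awfs) $(\mathsf L,\mathsf R)$ on $\mathcal E$ is a functorial factorization $f=\mathsf Rf\circ\mathsf Lf$ of the maps of $\mathcal E$ together with natural transformations $\mathsf L\to\mathsf L\mathsf L$ and $\mathsf R\mathsf R\to\mathsf R$ which make $\mathsf L$, with its canonical copointing $(\mathrm{id},\mathsf R)\colon\mathsf L\to\mathrm{Id}$, a comonad on $\mathcal E^\to$ and $\mathsf R$, with its canonical pointing $(\mathsf L,\mathrm{id})\colon\mathrm{Id}\to\mathsf R$, a monad on $\mathcal E^\to$, such that the canonical natural transformation $\mathsf L\mathsf R\to\mathsf R\mathsf L$ is a distributive law. It is algebraically-free on $u\colon\mathcal I\to\mathcal E^\to$ if its category of $\mathsf R$-monad algebras is isomorphic to $\mathcal I^{\pitchfork}$ over $\mathcal E^\to$. It is cofibrantly generated if it is algebraically-free on some $u\colon\mathcal I\to\mathcal E^\to$ with $\mathcal I$ small. For an awfs $(\mathsf C,\mathsf F_{\mathsf t})$ write $\mathsf{Cof}$ for the category of coalgebras for the copointed endofunctor $\mathsf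 C$, and $\mathsf{TrivFib}$ for the category of algebras for the monad $\mathsf F_{\mathsf t}$. The awfs is suitable if * (S1) it is cofibrantly generated; * (S2) the functor $\bot\colon\mathcal E\to\mathcal E^\to$, $X\mapsto(\bot_X\colon 0\to X)$, factors through the forgetful functor $\mathsf{Cof}\to\mathcal E^\to$; * (S3) the pullback functor $P\colon\mathcal E^\to\times_{\mathcal E}\mathcal E^\to\to\mathcal E^\to$, $(g,h)\mapsto h^*g$, defined on pairs of arrows with common codomain, lifts to a functor $\mathsf{Cof}\times_{\mathcal E}\mathcal E^\to\to\mathsf{Cof}$ over the forgetful functors; * (S4) for $k\in\{0,1\}$ the functor $\delta^k\mathbin{\hat\otimes}(-)\colon\mathcal E^\to\to\mathcal E^\to$ lifts to a functor $\mathsf{Cof}\to\mathsf{Cof}$ over the forgetful functors. **Theorem.** There exists a suitable awfs $(\mathsf C,\mathsf F_{\mathsf t})$ on $\mathcal E$ that is algebraically-free on the inclusion $\mathcal M\to\mathcal E^\to$, i.e. such that $\mathsf{TrivFib}\cong\mathcal M^{\pitchfork}$ over $\mathcal E^\to$. -/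

import Mathlib

open CategoryTheory Limits

universe w v u v₁ u₁ v₂ u₂

noncomputable section

namespace UniformFibrations

/-! ### Functorial cylinders -/

/-- A functorial cylinder on `E`: an endofunctor `I ⊗ (-)` together with two endpoint inclusions
`δ⁰ ⊗ (-), δ¹ ⊗ (-) : Id ⟶ I ⊗ (-)`. -/
structure FunctorialCylinder (E : Type u) [Category.{v} E] where
  /-- the endofunctor `I ⊗ (-)` -/
  cyl : E ⥤ E
  /-- the endpoint inclusions -/
  δ : Fin 2 → (𝟭 E ⟶ cyl)

/-- Contractions: a common retraction `ε ⊗ (-)` of the two endpoint inclusions. -/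
structure FunctorialCylinder.Contractions {E : Type u} [Category.{v} E]
    (Cyl : FunctorialCylinder E) where
  /-- the common retraction -/
  ε : Cyl.cyl ⟶ 𝟭 E
  δ_ε : ∀ k : Fin 2, Cyl.δ k ≫ ε = 𝟙 (𝟭 E)

/-- Connections `cᵏ ⊗ (-) : I ⊗ I ⊗ (-) ⟶ I ⊗ (-)`, for `k = 0, 1`, on a functorial cylinder with
contractions. In `Fin 2`, `1 - k` is the other endpoint. -/
structure FunctorialCylinder.Connections {E : Type u} [Category.{v} E]
    {Cyl : FunctorialCylinder E} (K : Cyl.Contractions) where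
  /-- the connection operations -/
  c : Fin 2 → (Cyl.cyl ⋙ Cyl.cyl ⟶ Cyl.cyl)
  /-- `cᵏ ∘ (δᵏ ⊗ I ⊗ X) = δᵏ ∘ ε` -/
  δ_cyl_c : ∀ (k : Fin 2) (X : E),
    (Cyl.δ k).app (Cyl.cyl.obj X) ≫ (c k).app X = K.ε.app X ≫ (Cyl.δ k).app X
  /-- `cᵏ ∘ (I ⊗ δᵏ ⊗ X) = δᵏ ∘ ε` -/
  cyl_δ_c : ∀ (k : Fin 2) (X : E),
    Cyl.cyl.map ((Cyl.δ k).app X) ≫ (c k).app X = K.ε.app X ≫ (Cyl.δ k).app X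
  /-- `cᵏ ∘ (δ¹⁻ᵏ ⊗ I ⊗ X) = id` -/
  δ_cyl_c' : ∀ (k : Fin 2) (X : E),
    (Cyl.δ (1 - k)).app (Cyl.cyl.obj X) ≫ (c k).app X = 𝟙 (Cyl.cyl.obj X)
  /-- `cᵏ ∘ (I ⊗ δ¹⁻ᵏ ⊗ X) = id` -/
  cyl_δ_c' : ∀ (k : Fin 2) (X : E),
    Cyl.cyl.map ((Cyl.δ (1 - k)).app X) ≫ (c k).app X = 𝟙 (Cyl.cyl.obj X)

/-- The Leibniz product functor `δᵏ ⊗̂ (-)` on arrows, for the evaluation bifunctor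
`(E ⥤ E) ⥤ (E ⥤ E)`: it sends `i : A ⟶ B` to the map `(I ⊗ A) +_A B ⟶ I ⊗ B` induced by
`I ⊗ i` and `δᵏ ⊗ B` out of the pushout of `δᵏ ⊗ A` and `i`. -/
def FunctorialCylinder.leibniz {E : Type u} [Category.{v} E] [HasPushouts E]
    (Cyl : FunctorialCylinder E) (k : Fin 2) : Arrow E ⥤ Arrow E :=
  (𝟭 (E ⥤ E)).leibnizPushout.obj (Arrow.mk (Cyl.δ k))

/-! ### The category of arrows and pullback squares -/

/-- The class of those morphisms of the arrow category which are pullback squares. -/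
def cartesianSquares (E : Type u) [Category.{v} E] : MorphismProperty (Arrow E) :=
  fun f g sq => IsPullback sq.left f.hom g.hom sq.right

instance (E : Type u) [Category.{v} E] : (cartesianSquares E).IsMultiplicative where
  id_mem f := IsPullback.of_horiz_isIso ⟨by simp⟩
  comp_mem _ _ h h' := IsPullback.paste_horiz h h'

/-- The category of arrows of `E` and pullback squares. -/
abbrev CartArrow (E : Type u) [Category.{v} E] := WideSubcategory (cartesianSquares E)

/-- A class of maps of `E`, viewed as a full subcategory of the category of arrows and pullback
squares. -/
abbrev CartSubcategory {E : Type u} [Category.{v} E] (M : MorphismProperty E) :=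
  ObjectProperty.FullSubcategory (C := CartArrow E) (fun f => M f.obj.hom)

/-- The inclusion of the full subcategory of arrows and pullback squares spanned by `M` into the
category of arrows. -/
abbrev CartSubcategory.incl {E : Type u} [Category.{v} E] (M : MorphismProperty E) :
    CartSubcategory M ⥤ Arrow E :=
  ObjectProperty.ι (C := CartArrow E) (fun f => M f.obj.hom) ⋙
    wideSubcategoryInclusion (cartesianSquares E)

/-! ### Right orthogonals -/

/-- A right `u`-map, for `u : I ⥤ Arrow E`: an arrow together with a choice of a diagonal filler for
every square from some `u.obj i` to it, naturally in `i`. -/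
structure RightMap {I : Type u₁} [Category.{v₁} I] {E : Type u} [Category.{v} E]
    (u : I ⥤ Arrow E) where
  /-- the underlying arrow -/
  arrow : Arrow E
  /-- the chosen fillers -/
  lift : ∀ (i : I) (_ : u.obj i ⟶ arrow), (u.obj i).right ⟶ arrow.left
  fac_left : ∀ (i : I) (sq : u.obj i ⟶ arrow), (u.obj i).hom ≫ lift i sq = sq.left
  fac_right : ∀ (i : I) (sq : u.obj i ⟶ arrow), lift i sq ≫ arrow.hom = sq.right
  naturality : ∀ {i j : I} (σ : i ⟶ j) (sq : u.obj j ⟶ arrow),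
    (u.map σ).right ≫ lift j sq = lift i (u.map σ ≫ sq)

namespace RightMap

variable {I : Type u₁} [Category.{v₁} I] {E : Type u} [Category.{v} E] {u : I ⥤ Arrow E}

/-- A morphism of right `u`-maps: a square compatible with the chosen fillers. -/
@[ext]
structure Hom (f g : RightMap u) where
  /-- the underlying square -/
  sq : f.arrow ⟶ g.arrow
  lift_comp : ∀ (i : I) (s : u.obj i ⟶ f.arrow), f.lift i s ≫ sq.left = g.lift i (s ≫ sq)

instance : Category (RightMap u) where
  Hom := Hom
  id f := ⟨𝟙 f.arrow, fun i s => by simp⟩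
  comp α β := ⟨α.sq ≫ β.sq, fun i s => by
    rw [Arrow.comp_left, ← Category.assoc, α.lift_comp, β.lift_comp, Category.assoc]⟩

variable (u) in
/-- The right orthogonal of `u`: the forgetful functor from right `u`-maps to arrows. -/
def forget : RightMap u ⥤ Arrow E where
  obj f := f.arrow
  map α := Hom.sq α

end RightMap

/-! ### Algebraic weak factorization systems -/

/-- Functorial factorizations of all maps of `E`. -/
abbrev FunctorialFactorization (E : Type u) [Category.{v} E] :=
  MorphismProperty.FunctorialFactorizationData (⊤ : MorphismProperty E) (⊤ : MorphismProperty E)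

namespace FunctorialFactorization

variable {E : Type u} [Category.{v} E] (F : FunctorialFactorization E)

/-- The left functor `L` of a functorial factorization. -/
@[simps]
def L : Arrow E ⥤ Arrow E where
  obj f := Arrow.mk (X := f.left) (Y := F.Z.obj f) (F.i.app f)
  map {f g} φ := Arrow.homMk (u := φ.left) (v := F.Z.map φ) (F.i.naturality φ)

/-- The right functor `R` of a functorial factorization. -/
@[simps]
def R : Arrow E ⥤ Arrow E where
  obj f := Arrow.mk (X := F.Z.obj f) (Y := f.right) (F.p.app f)
  map {f g} φ := Arrow.homMk (u := F.Z.map φ) (v := φ.right) (F.p.naturality φ)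

/-- The canonical copointing `(id, R) : L ⟶ Id`. -/
@[simps]
def counit : F.L ⟶ 𝟭 (Arrow E) where
  app f := Arrow.homMk (f := F.L.obj f) (g := f) (u := 𝟙 f.left) (v := F.p.app f)
    ((Category.id_comp f.hom).trans F.fac_app.symm)
  naturality f g φ := by
    ext
    · exact (Category.comp_id φ.left).trans (Category.id_comp φ.left).symm
    · exact F.p.naturality φ

/-- The canonical pointing `(L, id) : Id ⟶ R`. -/
@[simps]
def unit : 𝟭 (Arrow E) ⟶ F.R where
  app f := Arrow.homMk (f := f) (g := F.R.obj f) (u := F.i.app f) (v := 𝟙 f.right)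
    (F.fac_app.trans (Category.comp_id f.hom).symm)
  naturality f g φ := by
    ext
    · exact F.i.naturality φ
    · exact (Category.comp_id φ.right).trans (Category.id_comp φ.right).symm

end FunctorialFactorization

/-- A distributive law of a comonad `G` over a monad `T`: a natural transformation
`G T ⟶ T G` compatible with the unit, the counit, the multiplication and the comultiplication. -/
structure IsDistributiveLaw {A : Type u} [Category.{v} A] (G : Comonad A) (T : Monad A)
    (d : T.toFunctor ⋙ G.toFunctor ⟶ G.toFunctor ⋙ T.toFunctor) : Prop where
  unit : ∀ X : A, G.map (T.η.app X) ≫ d.app X = T.η.app (G.obj X)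
  counit : ∀ X : A, d.app X ≫ T.map (G.ε.app X) = G.ε.app (T.obj X)
  mul : ∀ X : A,
    G.map (T.μ.app X) ≫ d.app X = d.app (T.obj X) ≫ T.map (d.app X) ≫ T.μ.app (G.obj X)
  comul : ∀ X : A,
    d.app X ≫ T.map (G.δ.app X) = G.δ.app (T.obj X) ≫ G.map (d.app X) ≫ d.app (G.obj X)

/-- A functorial factorization together with a comultiplication making the copointed endofunctor
`L` a comonad and a multiplication making the pointed endofunctor `R` a monad. -/
structure PreAWFS (E : Type u) [Category.{v} E] where
  /-- the underlying functorial factorization -/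
  fact : FunctorialFactorization E
  /-- the comultiplication `L ⟶ L L` -/
  comul : fact.L ⟶ fact.L ⋙ fact.L
  /-- the multiplication `R R ⟶ R` -/
  mul : fact.R ⋙ fact.R ⟶ fact.R
  coassoc : ∀ f, comul.app f ≫ fact.L.map (comul.app f) =
    comul.app f ≫ comul.app (fact.L.obj f)
  left_counit : ∀ f, comul.app f ≫ fact.counit.app (fact.L.obj f) = 𝟙 (fact.L.obj f)
  right_counit : ∀ f, comul.app f ≫ fact.L.map (fact.counit.app f) = 𝟙 (fact.L.obj f)
  assoc : ∀ f, fact.R.map (mul.app f) ≫ mul.app f = mul.app (fact.R.obj f) ≫ mul.app f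
  left_unit : ∀ f, fact.unit.app (fact.R.obj f) ≫ mul.app f = 𝟙 (fact.R.obj f)
  right_unit : ∀ f, fact.R.map (fact.unit.app f) ≫ mul.app f = 𝟙 (fact.R.obj f)

namespace PreAWFS

variable {E : Type u} [Category.{v} E] (W : PreAWFS E)

/-- The comonad on `L`. -/
def comonad : Comonad (Arrow E) where
  toFunctor := W.fact.L
  ε := W.fact.counit
  δ := W.comul
  coassoc := W.coassoc
  left_counit := W.left_counit
  right_counit := W.right_counit

/-- The monad on `R`. -/
def monad : Monad (Arrow E) where
  toFunctor := W.fact.R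
  η := W.fact.unit
  μ := W.mul
  assoc := W.assoc
  left_unit := W.left_unit
  right_unit := W.right_unit

/-- The canonical transformation `L R ⟶ R L`: at `f`, it is the square from `L (R f)` to `R (L f)`
with top the codomain component of the comultiplication at `f` and bottom the domain component of
the multiplication at `f`. Both composites of this square are the identity. -/
def canonical : W.fact.R ⋙ W.fact.L ⟶ W.fact.L ⋙ W.fact.R where
  app f := Arrow.homMk (f := W.fact.L.obj (W.fact.R.obj f)) (g := W.fact.R.obj (W.fact.L.obj f))
    (u := (W.comul.app f).right) (v := (W.mul.app f).left) (by
      have h₁ := congrArg CommaMorphism.right (W.left_counit f)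
      have h₂ := congrArg CommaMorphism.left (W.left_unit f)
      exact h₁.trans h₂.symm)
  naturality f g φ := by
    ext
    · exact congrArg CommaMorphism.right (W.comul.naturality φ)
    · exact congrArg CommaMorphism.left (W.mul.naturality φ)

end PreAWFS

/-- An algebraic weak factorization system on `E`. -/
structure AWFS (E : Type u) [Category.{v} E] extends PreAWFS E where
  distrib : IsDistributiveLaw toPreAWFS.comonad toPreAWFS.monad toPreAWFS.canonical

namespace AWFS

variable {E : Type u} [Category.{v} E] (W : AWFS E)

/-- The category of coalgebras for the copointed endofunctor `L`: coalgebras for the endofunctor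
whose structure map is a section of the copointing. Coassociativity is not required. -/
abbrev Cof :=
  ObjectProperty.FullSubcategory (C := Endofunctor.Coalgebra W.fact.L)
    (fun c => c.str ≫ W.fact.counit.app c.V = 𝟙 c.V)

/-- The forgetful functor from `Cof` to arrows. -/
abbrev cofForget : W.Cof ⥤ Arrow E :=
  ObjectProperty.ι (C := Endofunctor.Coalgebra W.fact.L)
    (fun c => c.str ≫ W.fact.counit.app c.V = 𝟙 c.V) ⋙ Endofunctor.Coalgebra.forget W.fact.L

/-- The category of algebras for the monad `R`. -/
abbrev TrivFib := W.monad.Algebra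

/-- The forgetful functor from `TrivFib` to arrows. -/
abbrev trivFibForget : W.TrivFib ⥤ Arrow E := W.monad.forget

end AWFS

/-- Isomorphism of categories over `B`. -/
def IsoOver {B : Type u} [Category.{v} B] {J : Type u₁} [Category.{v₁} J] {K : Type u₂}
    [Category.{v₂} K] (U : J ⥤ B) (V : K ⥤ B) : Prop :=
  ∃ (F : J ⥤ K) (G : K ⥤ J), F ⋙ G = 𝟭 J ∧ G ⋙ F = 𝟭 K ∧ F ⋙ V = U

/-- The awfs is algebraically-free on `u : I ⥤ Arrow E`: its category of monad algebras is
isomorphic, over the category of arrows, to the category of right `u`-maps. -/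
def AWFS.AlgebraicallyFree {E : Type u} [Category.{v} E] (W : AWFS E)
    {I : Type u₁} [Category.{v₁} I] (u : I ⥤ Arrow E) : Prop :=
  IsoOver W.trivFibForget (RightMap.forget u)

/-- The awfs is cofibrantly generated: it is algebraically-free on a small category of arrows.
Small means small relative to the universe `w`. -/
def AWFS.CofibrantlyGenerated {E : Type u} [Category.{v} E] (W : AWFS E) : Prop :=
  ∃ (I : Type w) (_ : SmallCategory I) (u : I ⥤ Arrow E), W.AlgebraicallyFree u

/-! ### Suitable algebraic weak factorization systems -/

/-- The functor sending `X` to the unique map `0 ⟶ X`. -/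
def botFunctor (E : Type u) [Category.{v} E] [HasInitial E] : E ⥤ Arrow E where
  obj X := Arrow.mk (initial.to X)
  map {X Y} f := Arrow.homMk (f := Arrow.mk (initial.to X)) (g := Arrow.mk (initial.to Y))
    (u := 𝟙 (⊥_ E)) (v := f) (by simp)

/-- For `U : J ⥤ Arrow E`, the category `J ×_E Arrow E` of pairs consisting of an object `j` of `J`
and a map `h : Y ⟶ B` into the codomain of `U.obj j : A ⟶ B`. -/
abbrev CospanOver {E : Type u} [Category.{v} E] {J : Type u₁} [Category.{v₁} J]
    (U : J ⥤ Arrow E) := Comma (𝟭 E) (U ⋙ Arrow.rightFunc)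

/-- The pullback functor `P`, sending a cospan `(g : A ⟶ B, h : Y ⟶ B)` to the arrow
`h^* g : A ×_B Y ⟶ Y`. -/
def pullbackFunctor (E : Type u) [Category.{v} E] [HasPullbacks E] :
    Comma (𝟭 E) (Arrow.rightFunc : Arrow E ⥤ E) ⥤ Arrow E where
  obj c := Arrow.mk (X := pullback c.right.hom c.hom) (Y := c.left)
    (pullback.snd c.right.hom c.hom)
  map {c d} φ := Arrow.homMk
    (f := Arrow.mk (pullback.snd c.right.hom c.hom))
    (g := Arrow.mk (pullback.snd d.right.hom d.hom))
    (u := pullback.map c.right.hom c.hom d.right.hom d.hom φ.right.left φ.left φ.right.right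
      (Arrow.w φ.right).symm φ.w.symm)
    (v := φ.left) (pullback.lift_snd _ _ _)
  map_id c := by
    ext
    · exact pullback.map_id
    · rfl
  map_comp φ ψ := by
    ext
    · exact (pullback.map_comp (i₃ := φ.right.right) (j₃ := ψ.right.right)
        (e₁ := (Arrow.w φ.right).symm) (e₂ := φ.w.symm)
        (e₃ := (Arrow.w ψ.right).symm) (e₄ := ψ.w.symm) ..).symm
    · rfl

/-- An awfs is suitable (with respect to a functorial cylinder) if it is cofibrantly generated and
if the functors `⊥`, pullback, and Leibniz product with the endpoint inclusions lift to `Cof`. -/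
structure AWFS.IsSuitable {E : Type u} [Category.{v} E] [HasInitial E] [HasPullbacks E]
    [HasPushouts E] (W : AWFS E) (Cyl : FunctorialCylinder E) : Prop where
  /-- the awfs is cofibrantly generated, by a small category of arrows -/
  cofibrantlyGenerated : AWFS.CofibrantlyGenerated.{w} W
  /-- `⊥ : E ⥤ Arrow E` factors through `Cof` -/
  bot : ∃ F : E ⥤ W.Cof, F ⋙ W.cofForget = botFunctor E
  /-- the pullback functor lifts to a functor `Cof ×_E Arrow E ⥤ Cof` -/
  pullback : ∃ F : CospanOver W.cofForget ⥤ W.Cof,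
    F ⋙ W.cofForget = Comma.preRight (𝟭 E) W.cofForget Arrow.rightFunc ⋙ pullbackFunctor E
  /-- the Leibniz product functors `δᵏ ⊗̂ (-)` lift to functors `Cof ⥤ Cof` -/
  leibniz : ∀ k : Fin 2, ∃ F : W.Cof ⥤ W.Cof, F ⋙ W.cofForget = W.cofForget ⋙ Cyl.leibniz k

end UniformFibrations

end

/-!
All maps of `M` are monomorphisms stable under pullback, and a filler for a monomorphism `m` against
`f` can be found element by element: an element of the codomain of `m` over `c` pulls `m` back to
the inclusion of a sieve on `c`. So `M^⋔` is the category of right maps for the small category of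
those sieve inclusions `S ⟶ y(c)` that lie in `M`: such a right map is a map `f` together with, over
each element of its codomain, a chosen extension of every matching family on every such sieve,
stably under restriction. The free such structure on `f` consists of well-founded trees, which
are elements of the domain of `f` or formal extensions of families of trees. Freeness gives the
monad, the comonad and the distributive law.

A formal extension is formed over one element of the codomain only, so the free structure
commutes with base change; hence coalgebras can be pulled back. The map `0 ⟶ X` is a coalgebra since
the empty family on the empty sieve can be extended. Finally, `δᵏ ⊗̂ (-)` preserves `M` and
cartesian squares between maps of `M`, so transposing fillers lifts its right adjoint `P` to right
maps, that is, to algebras. By freeness the transpose of `δᵏ ⊗̂ i ⟶ R (δᵏ ⊗̂ i)` extends to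
`R i ⟶ P (R (δᵏ ⊗̂ i))`. Composed with this, a coalgebra structure on `i` transposes to one on
`δᵏ ⊗̂ i`.
-/

noncomputable section

namespace UniformFibrations

open Opposite

variable {C : Type u} [SmallCategory C]

/-! ### Extension structures for compatible families -/

/-- A class of sieves that is closed under pullback. -/
structure StableSieves (C : Type u) [SmallCategory C] where
  /-- the sieves of the class -/
  mem : ∀ {c : C}, Sieve c → Prop
  pullback_mem : ∀ {c d : C} (g : d ⟶ c) {S : Sieve c}, mem S → mem (S.pullback g)

/-- A compatible family of elements of `X` indexed by the sieve `S`, lying over the restrictions of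
the element `y` of `Y`. This is a square from the inclusion of `S` into the representable presheaf
of `c` to `f`. -/
structure Family {X Y : Cᵒᵖ ⥤ Type u} (f : X ⟶ Y) {c : C} (S : Sieve c) (y : Y.obj (op c)) where
  /-- the elements of the family -/
  val : ∀ {d : C} (g : d ⟶ c), S g → X.obj (op d)
  map_val : ∀ {d e : C} (g : d ⟶ c) (hg : S g) (k : e ⟶ d),
    X.map k.op (val g hg) = val (k ≫ g) (S.downward_closed hg k)
  app_val : ∀ {d : C} (g : d ⟶ c) (hg : S g), f.app (op d) (val g hg) = Y.map g.op y

namespace Family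

variable {X Y Z X' Y' : Cᵒᵖ ⥤ Type u} {f : X ⟶ Y} {f' : X' ⟶ Y'} {g : Y ⟶ Z} {c : C}
  {S : Sieve c} {y : Y.obj (op c)} {z : Z.obj (op c)}

@[ext]
lemma ext {s t : Family f S y} (h : ∀ {d : C} (k : d ⟶ c) (hk : S k), s.val k hk = t.val k hk) :
    s = t := by
  obtain ⟨s, _, _⟩ := s
  obtain ⟨t, _, _⟩ := t
  obtain rfl : @s = @t := by
    funext d k hk
    exact h k hk
  rfl

/-- The restriction of a family along a map of the base. -/
@[simps]
def restrict (s : Family f S y) {d : C} (g : d ⟶ c) :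
    Family f (S.pullback g) (Y.map g.op y) where
  val k hk := s.val (k ≫ g) hk
  map_val k hk l := by simpa using s.map_val (k ≫ g) hk l
  app_val k hk := by simpa using s.app_val (k ≫ g) hk

/-- The image of a family under a commutative square. -/
@[simps]
def pushforward (s : Family f S y) (a : X ⟶ X') (b : Y ⟶ Y') (w : a ≫ f' = f ≫ b) :
    Family f' S (b.app (op c) y) where
  val k hk := a.app _ (s.val k hk)
  map_val k hk l := by rw [← NatTrans.naturality_apply, s.map_val]
  app_val k hk := by
    rw [← NatTrans.comp_app_apply, w, NatTrans.comp_app_apply, s.app_val,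
      NatTrans.naturality_apply]

/-- The image in `Y` of a family for a composite `X ⟶ Y ⟶ Z`. -/
def image (s : Family (f ≫ g) S z) : Family g S z where
  val k hk := f.app _ (s.val k hk)
  map_val k hk l := by rw [← NatTrans.naturality_apply, s.map_val]
  app_val k hk := s.app_val k hk

/-- A family for a composite `X ⟶ Y ⟶ Z`, viewed as a family over an element of `Y` that extends
its image in `Y`. -/
def overExtension (s : Family (f ≫ g) S z) (y : Y.obj (op c))
    (hy : ∀ {d : C} (k : d ⟶ c) (hk : S k), Y.map k.op y = s.image.val k hk) :
    Family f S y where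
  val k hk := s.val k hk
  map_val k hk l := s.map_val k hk l
  app_val k hk := (hy k hk).symm

/-- Transport of a family along an equality of base elements. -/
def cast (s : Family f S y) {y' : Y.obj (op c)} (h : y = y') : Family f S y' where
  val k hk := s.val k hk
  map_val k hk l := s.map_val k hk l
  app_val k hk := by rw [s.app_val, h]

end Family

/-- An extension structure on `f : X ⟶ Y`: a choice of an extension to an element over `y` of every
compatible family over `y` indexed by a sieve in `J`, compatibly with restriction. -/
structure SieveAlg (J : StableSieves C) {X Y : Cᵒᵖ ⥤ Type u} (f : X ⟶ Y) where
  /-- the extension operation -/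
  extend : ∀ {c : C} {S : Sieve c} {y : Y.obj (op c)}, J.mem S → Family f S y → X.obj (op c)
  app_extend : ∀ {c : C} {S : Sieve c} {y : Y.obj (op c)} (hS : J.mem S) (s : Family f S y),
    f.app (op c) (extend hS s) = y
  map_extend_of_mem : ∀ {c : C} {S : Sieve c} {y : Y.obj (op c)} (hS : J.mem S) (s : Family f S y)
    {d : C} (g : d ⟶ c) (hg : S g), X.map g.op (extend hS s) = s.val g hg
  map_extend : ∀ {c : C} {S : Sieve c} {y : Y.obj (op c)} (hS : J.mem S) (s : Family f S y)
    {d : C} (g : d ⟶ c), X.map g.op (extend hS s) = extend (J.pullback_mem g hS) (s.restrict g)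

namespace SieveAlg

variable {J : StableSieves C} {X Y Z X' Y' Z' X'' Y'' : Cᵒᵖ ⥤ Type u} {f : X ⟶ Y} {g : Y ⟶ Z}
  {f' : X' ⟶ Y'} {g' : Y' ⟶ Z'} {f'' : X'' ⟶ Y''}

lemma extend_congr (α : SieveAlg J f) {c : C} {S S' : Sieve c} {hS : J.mem S} {hS' : J.mem S'}
    {y y' : Y.obj (op c)} {s : Family f S y} {s' : Family f S' y'} (eq_sieve : S = S')
    (eq_base : y = y') (eq_val : ∀ {d : C} (k : d ⟶ c) (h : S k) (h' : S' k),
      s.val k h = s'.val k h') : α.extend hS s = α.extend hS' s' := by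
  subst eq_sieve eq_base
  congr 1
  ext d k hk
  exact eq_val k hk hk

lemma extend_of_mem_id (α : SieveAlg J f) {c : C} {S : Sieve c} (hS : J.mem S)
    {y : Y.obj (op c)} (s : Family f S y) (h : S (𝟙 c)) : α.extend hS s = s.val (𝟙 c) h := by
  simpa using α.map_extend_of_mem hS s (𝟙 c) h

@[ext]
lemma ext {α β : SieveAlg J f} (h : ∀ {c : C} {S : Sieve c} {y : Y.obj (op c)} (hS : J.mem S)
    (s : Family f S y), α.extend hS s = β.extend hS s) : α = β := by
  obtain ⟨a, _, _, _⟩ := α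
  obtain ⟨b, _, _, _⟩ := β
  obtain rfl : @a = @b := by
    funext c S y hS s
    exact h hS s
  rfl

/-- A commutative square that preserves the chosen extensions. -/
structure IsHom (α : SieveAlg J f) (β : SieveAlg J f') (a : X ⟶ X') (b : Y ⟶ Y') : Prop where
  w : a ≫ f' = f ≫ b
  app_extend : ∀ {c : C} {S : Sieve c} {y : Y.obj (op c)} (hS : J.mem S) (s : Family f S y),
    a.app (op c) (α.extend hS s) = β.extend hS (s.pushforward a b w)

lemma IsHom.id (α : SieveAlg J f) : IsHom α α (𝟙 X) (𝟙 Y) where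
  w := by simp
  app_extend _ _ := rfl

lemma IsHom.comp {α : SieveAlg J f} {β : SieveAlg J f'} {γ : SieveAlg J f''}
    {a : X ⟶ X'} {b : Y ⟶ Y'} {a' : X' ⟶ X''} {b' : Y' ⟶ Y''}
    (h : IsHom α β a b) (h' : IsHom β γ a' b') : IsHom α γ (a ≫ a') (b ≫ b') where
  w := by rw [Category.assoc, h'.w, ← Category.assoc, h.w, Category.assoc]
  app_extend hS s := by
    rw [NatTrans.comp_app_apply, h.app_extend, h'.app_extend]
    rfl

/-- The extension structure on a composite: first extend the image in `Y`, then extend the family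
over the result. -/
def comp (α : SieveAlg J f) (β : SieveAlg J g) : SieveAlg J (f ≫ g) where
  extend hS s := α.extend hS (s.overExtension (β.extend hS s.image)
    (β.map_extend_of_mem hS s.image))
  app_extend hS s := by rw [NatTrans.comp_app_apply, α.app_extend, β.app_extend]
  map_extend_of_mem hS s d k hk := α.map_extend_of_mem _ _ k hk
  map_extend hS s d k := by
    rw [α.map_extend]
    exact α.extend_congr rfl (β.map_extend hS s.image k) fun _ _ _ => rfl

lemma comp_extend (α : SieveAlg J f) (β : SieveAlg J g) {c : C} {S : Sieve c} {z : Z.obj (op c)}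
    (hS : J.mem S) (s : Family (f ≫ g) S z) :
    (α.comp β).extend hS s = α.extend hS (s.overExtension (β.extend hS s.image)
      (β.map_extend_of_mem hS s.image)) :=
  rfl

lemma IsHom.horizComp {α : SieveAlg J f} {β : SieveAlg J g} {α' : SieveAlg J f'}
    {β' : SieveAlg J g'} {a : X ⟶ X'} {b : Y ⟶ Y'} {c : Z ⟶ Z'} (h : IsHom α α' a b)
    (h' : IsHom β β' b c) : IsHom (α.comp β) (α'.comp β') a c where
  w := by rw [← Category.assoc, h.w, Category.assoc, h'.w, Category.assoc]
  app_extend hS s := by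
    rw [comp_extend, comp_extend, h.app_extend]
    refine α'.extend_congr rfl ?_ fun _ _ _ => rfl
    rw [h'.app_extend]
    exact β'.extend_congr rfl rfl fun k hk _ =>
      (congrArg (fun t => t.app (op _) (s.val k hk)) h.w).symm

lemma IsHom.comp_right (α : SieveAlg J f) (β : SieveAlg J g) :
    IsHom (α.comp β) β f (𝟙 Z) where
  w := by simp
  app_extend hS s := α.app_extend hS _

lemma IsHom.comp_over {α : SieveAlg J f} {k : X' ⟶ Z} {γ : SieveAlg J k} {a : X ⟶ X'}
    (h : IsHom α γ a g) (β : SieveAlg J g) : IsHom (α.comp β) γ a (𝟙 Z) where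
  w := by rw [h.w, Category.comp_id]
  app_extend hS s := by
    rw [comp_extend, h.app_extend]
    exact γ.extend_congr rfl (β.app_extend hS _) fun _ _ _ => rfl

lemma IsHom.assoc {W : Cᵒᵖ ⥤ Type u} {k : Z ⟶ W} (α : SieveAlg J f) (β : SieveAlg J g)
    (γ : SieveAlg J k) :
    IsHom ((α.comp β).comp γ) (α.comp (β.comp γ)) (𝟙 X) (𝟙 W) where
  w := by simp
  app_extend _ _ := rfl

end SieveAlg

/-! ### Free extension structures -/

/-- A formal iterated extension: an element of `X`, or an element of `Y` together with a family of
trees indexed by a sieve. -/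
inductive Tree (X Y : Cᵒᵖ ⥤ Type u) : C → Type u
  | leaf {c : C} (x : X.obj (op c)) : Tree X Y c
  | node {c : C} (S : Sieve c) (y : Y.obj (op c)) (s : ∀ (d : C) (g : d ⟶ c), S g → Tree X Y d) :
      Tree X Y c

namespace Tree

variable {X Y X' Y' : Cᵒᵖ ⥤ Type u}

open Classical in
/-- The restriction of a tree. Restricting a node along a map of its sieve selects a branch, so that
a node extends the family of its branches. -/
def map {c d : C} (t : Tree X Y c) (g : d ⟶ c) : Tree X Y d :=
  match t with
  | leaf x => leaf (X.map g.op x)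
  | node S y s =>
    if h : S g then s d g h
    else node (S.pullback g) (Y.map g.op y) fun e k hk =>
      s e (k ≫ g) ((Sieve.pullback_apply g S e k).mp hk)

/-- The element of `Y` over which a tree lies. -/
def label (f : X ⟶ Y) {c : C} (t : Tree X Y c) : Y.obj (op c) :=
  match t with
  | leaf x => f.app (op c) x
  | node _ y _ => y

/-- A tree is well-formed if the branches at each node form a compatible family indexed by a
non-maximal sieve in `J`. Maximal sieves are excluded because an extension along a maximal sieve is
already determined by the family. -/
def WellFormed (J : StableSieves C) (f : X ⟶ Y) {c : C} (t : Tree X Y c) : Prop :=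
  match t with
  | leaf _ => True
  | @node _ _ _ _ c S y s => J.mem S ∧ ¬ S (𝟙 c) ∧ ∀ (d : C) (g : d ⟶ c) (h : S g),
      (s d g h).WellFormed J f ∧ (s d g h).label f = Y.map g.op y ∧
        ∀ (e : C) (k : e ⟶ d), (s d g h).map k = s e (k ≫ g) (S.downward_closed h k)

variable {J : StableSieves C} {f : X ⟶ Y}

section Node

variable {c d : C} {S : Sieve c} {y : Y.obj (op c)}
  {s : ∀ (d : C) (g : d ⟶ c), S g → Tree X Y d} {g : d ⟶ c}

lemma map_node_of_mem (hg : S g) : (node S y s).map g = s d g hg := by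
  simp [map, hg]

lemma map_node_of_not_mem (hg : ¬ S g) : (node S y s).map g =
    node (S.pullback g) (Y.map g.op y) fun e k hk =>
      s e (k ≫ g) ((Sieve.pullback_apply g S e k).mp hk) := by
  simp [map, hg]

lemma node_congr {S' : Sieve c} {y' : Y.obj (op c)}
    {s' : ∀ (d : C) (g : d ⟶ c), S' g → Tree X Y d} (eq_sieve : S = S') (eq_base : y = y')
    (eq_branch : ∀ (d : C) (g : d ⟶ c) (h : S g) (h' : S' g), s d g h = s' d g h') :
    node S y s = node S' y' s' := by
  subst eq_sieve eq_base
  congr 1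
  funext d g h
  exact eq_branch d g h h

end Node

lemma WellFormed.map {c d : C} {t : Tree X Y c} (ht : t.WellFormed J f) (g : d ⟶ c) :
    (t.map g).WellFormed J f := by
  cases t with
  | leaf x => trivial
  | node S y s =>
    obtain ⟨hS, -, hs⟩ := ht
    by_cases hg : S g
    · rw [map_node_of_mem hg]
      exact (hs d g hg).1
    · rw [map_node_of_not_mem hg]
      refine ⟨J.pullback_mem g hS, by simpa using hg, fun e k hk => ⟨(hs _ _ _).1, ?_, ?_⟩⟩
      · rw [(hs _ _ _).2.1]
        simp
      · intro e' k'
        simp only [(hs _ _ _).2.2, Category.assoc]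

lemma label_map {c d : C} {t : Tree X Y c} (ht : t.WellFormed J f) (g : d ⟶ c) :
    (t.map g).label f = Y.map g.op (t.label f) := by
  cases t with
  | leaf x => exact NatTrans.naturality_apply f g.op x
  | node S y s =>
    by_cases hg : S g
    · rw [map_node_of_mem hg]
      exact (ht.2.2 d g hg).2.1
    · rw [map_node_of_not_mem hg]
      rfl

lemma map_id {c : C} {t : Tree X Y c} (ht : t.WellFormed J f) : t.map (𝟙 c) = t := by
  cases t with
  | leaf x => exact congrArg leaf (by simp)
  | node S y s =>
    rw [map_node_of_not_mem ht.2.1]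
    refine node_congr Sieve.pullback_id (by simp) fun d g _ _ => ?_
    simp only [Category.comp_id]

lemma map_comp {c d e : C} {t : Tree X Y c} (ht : t.WellFormed J f) (g : d ⟶ c) (k : e ⟶ d) :
    t.map (k ≫ g) = (t.map g).map k := by
  cases t with
  | leaf x => exact congrArg leaf (by simp)
  | node S y s =>
    by_cases hg : S g
    · rw [map_node_of_mem hg, map_node_of_mem (S.downward_closed hg k), (ht.2.2 d g hg).2.2]
    · rw [map_node_of_not_mem hg]
      by_cases hkg : S (k ≫ g)
      · rw [map_node_of_mem hkg, map_node_of_mem (S := S.pullback g) hkg]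
      · rw [map_node_of_not_mem hkg, map_node_of_not_mem (S := S.pullback g) hkg]
        refine node_congr (Sieve.pullback_comp _) (by simp) fun d l _ _ => ?_
        simp only [Category.assoc]

section Evaluation

variable {f' : X' ⟶ Y'} {β : SieveAlg J f'} {a : X ⟶ X'} {b : Y ⟶ Y'}

/-- The graph of the evaluation of trees in the extension structure `β`. Evaluation is a relation
because the values of the branches of a node are compatible, and can be extended, only after
evaluation is known to commute with restriction. -/
inductive EvaluatesTo (β : SieveAlg J f') (a : X ⟶ X') (b : Y ⟶ Y') :
    ∀ {c : C}, Tree X Y c → X'.obj (op c) → Prop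
  | leaf {c : C} (x : X.obj (op c)) : EvaluatesTo β a b (leaf x) (a.app (op c) x)
  | node {c : C} {S : Sieve c} {y : Y.obj (op c)} {s : ∀ (d : C) (g : d ⟶ c), S g → Tree X Y d}
      (hS : J.mem S) (v : Family f' S (b.app (op c) y))
      (_ : ∀ (d : C) (g : d ⟶ c) (hg : S g), EvaluatesTo β a b (s d g hg) (v.val g hg)) :
      EvaluatesTo β a b (node S y s) (β.extend hS v)

namespace EvaluatesTo

lemma unique {c : C} {t : Tree X Y c} {x x' : X'.obj (op c)} (h : t.EvaluatesTo β a b x)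
    (h' : t.EvaluatesTo β a b x') : x = x' := by
  induction h with
  | leaf x => cases h'; rfl
  | node hS v _ ih =>
    cases h' with
    | node hS v' hv' => exact β.extend_congr rfl rfl fun g hg _ => ih _ g hg (hv' _ g hg)

lemma map {c d : C} {t : Tree X Y c} {x : X'.obj (op c)} (h : t.EvaluatesTo β a b x)
    (g : d ⟶ c) : (t.map g).EvaluatesTo β a b (X'.map g.op x) := by
  cases h with
  | leaf x =>
    rw [← NatTrans.naturality_apply]
    exact .leaf _
  | @node _ S y s hS v hv =>
    by_cases hg : S g
    · rw [map_node_of_mem hg, β.map_extend_of_mem hS v g hg]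
      exact hv d g hg
    · have hy : Y'.map g.op (b.app (op c) y) = b.app (op d) (Y.map g.op y) :=
        (NatTrans.naturality_apply b g.op y).symm
      rw [map_node_of_not_mem hg, β.map_extend,
        β.extend_congr (hS' := J.pullback_mem g hS) (s' := (v.restrict g).cast hy) rfl hy
          fun _ _ _ => rfl]
      exact .node _ _ fun e k hk => hv e (k ≫ g) hk

lemma app {c : C} {t : Tree X Y c} {x : X'.obj (op c)} (h : t.EvaluatesTo β a b x)
    (w : a ≫ f' = f ≫ b) : f'.app (op c) x = b.app (op c) (t.label f) := by
  cases h with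
  | leaf x => exact congrArg (fun t => t.app (op c) x) w
  | node hS v _ => exact β.app_extend hS v

end EvaluatesTo

lemma WellFormed.exists_evaluatesTo {c : C} {t : Tree X Y c} (ht : t.WellFormed J f)
    (w : a ≫ f' = f ≫ b) : ∃ x, t.EvaluatesTo β a b x := by
  induction t with
  | leaf x => exact ⟨_, .leaf x⟩
  | @node c S y s ih =>
    obtain ⟨hS, -, hs⟩ := ht
    choose v hv using fun d g hg => ih d g hg (hs d g hg).1
    let family : Family f' S (b.app (op c) y) :=
      { val := fun {d} g hg => v d g hg
        map_val := fun {d e} g hg k =>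
          EvaluatesTo.unique ((hv d g hg).map k) ((hs d g hg).2.2 e k ▸ hv e (k ≫ g) _)
        app_val := fun {d} g hg => by
          rw [(hv d g hg).app w, (hs d g hg).2.1, NatTrans.naturality_apply] }
    exact ⟨_, .node hS family hv⟩

end Evaluation

end Tree

section Free

variable (J : StableSieves C) {X Y X' Y' X'' Y'' : Cᵒᵖ ⥤ Type u} (f : X ⟶ Y) {f' : X' ⟶ Y'}
  {f'' : X'' ⟶ Y''}

/-- The domain of the free extension structure on `f`: the presheaf of well-formed trees. -/
def free : Cᵒᵖ ⥤ Type u where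
  obj c := {t : Tree X Y c.unop // t.WellFormed J f}
  map g := TypeCat.ofHom fun t => ⟨t.1.map g.unop, t.2.map g.unop⟩
  map_id c := by
    ext t
    exact Tree.map_id t.2
  map_comp g k := by
    ext t
    exact Tree.map_comp t.2 g.unop k.unop

namespace free

/-- The inclusion of the generators. -/
def leaf : X ⟶ free J f where
  app c := TypeCat.ofHom fun x => ⟨Tree.leaf x, trivial⟩

/-- The free extension structure is carried by this map. -/
def proj : free J f ⟶ Y where
  app c := TypeCat.ofHom fun t => t.1.label f
  naturality c d g := by
    ext t
    exact Tree.label_map t.2 g.unop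

lemma leaf_proj : leaf J f ≫ proj J f = f := rfl

variable {J f}

section Node

variable {c d : C} {S : Sieve c} {y : Y.obj (op c)}

/-- The formal extension of a family indexed by a non-maximal sieve. -/
def node (hS : J.mem S) (hid : ¬ S (𝟙 c)) (s : Family (proj J f) S y) : (free J f).obj (op c) :=
  ⟨Tree.node S y fun _ g hg => (s.val g hg).1, hS, hid, fun _ g hg =>
    ⟨(s.val g hg).2, s.app_val g hg, fun _ k => congrArg Subtype.val (s.map_val g hg k)⟩⟩

lemma map_node_of_mem (hS : J.mem S) (hid : ¬ S (𝟙 c)) (s : Family (proj J f) S y) {g : d ⟶ c}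
    (hg : S g) : (free J f).map g.op (node hS hid s) = s.val g hg :=
  Subtype.ext (Tree.map_node_of_mem (y := y) (s := fun _ k hk => (s.val k hk).1) hg)

lemma map_node_of_not_mem (hS : J.mem S) (hid : ¬ S (𝟙 c)) (s : Family (proj J f) S y)
    {g : d ⟶ c} (hg : ¬ S.pullback g (𝟙 d)) :
    (free J f).map g.op (node hS hid s) = node (J.pullback_mem g hS) hg (s.restrict g) :=
  Subtype.ext (Tree.map_node_of_not_mem (y := y) (s := fun _ k hk => (s.val k hk).1)
    (by simpa using hg))

end Node

variable (J f)

open Classical in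
/-- The extension structure on the free one: families indexed by a maximal sieve are extended by
their value at the identity, all other ones formally. -/
def alg : SieveAlg J (proj J f) where
  extend {c S y} hS s := if hid : S (𝟙 c) then s.val (𝟙 c) hid else node hS hid s
  app_extend {c S y} hS s := by
    split_ifs with hid
    · simp [s.app_val]
    · rfl
  map_extend_of_mem {c S y} hS s d g hg := by
    split_ifs with hid
    · simp [s.map_val]
    · exact map_node_of_mem hS hid s hg
  map_extend {c S y} hS s d g := by
    by_cases hid : S (𝟙 c)
    · have hg : S.pullback g (𝟙 d) := by simpa using S.downward_closed hid g
      rw [dif_pos hid, dif_pos hg, s.map_val]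
      simp
    · rw [dif_neg hid]
      split_ifs with hg
      · rw [map_node_of_mem hS hid s (by simpa using hg)]
        simp
      · exact map_node_of_not_mem hS hid s hg

variable {J f}

lemma alg_extend_of_not_mem {c : C} {S : Sieve c} {y : Y.obj (op c)} (hS : J.mem S)
    (hid : ¬ S (𝟙 c)) (s : Family (proj J f) S y) : (alg J f).extend hS s = node hS hid s :=
  dif_neg hid

@[elab_as_elim]
lemma induction {P : ∀ {c : C}, (free J f).obj (op c) → Prop}
    (leaf : ∀ {c : C} (x : X.obj (op c)), P ((leaf J f).app (op c) x))
    (node : ∀ {c : C} {S : Sieve c} {y : Y.obj (op c)} (hS : J.mem S) (hid : ¬ S (𝟙 c))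
      (s : Family (proj J f) S y), (∀ {d : C} (g : d ⟶ c) (hg : S g), P (s.val g hg)) →
        P (node hS hid s)) {c : C} (t : (free J f).obj (op c)) : P t := by
  obtain ⟨t, ht⟩ := t
  change Tree X Y c at t
  induction t with
  | leaf x => exact leaf x
  | @node c S y s ih =>
    have ⟨hS, hid, hs⟩ := ht
    exact node hS hid
      { val := fun {d} g hg => ⟨s d g hg, (hs d g hg).1⟩
        map_val := fun {d e} g hg k => Subtype.ext ((hs d g hg).2.2 e k)
        app_val := fun {d} g hg => (hs d g hg).2.1 }
      fun {d} g hg => ih d g hg (hs d g hg).1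

section Lift

variable (β : SieveAlg J f') (a : X ⟶ X') (b : Y ⟶ Y') (w : a ≫ f' = f ≫ b)

/-- The map out of the free extension structure induced by a square from `f` to the underlying map
of an extension structure. -/
def lift : free J f ⟶ X' where
  app c := TypeCat.ofHom fun t => (t.2.exists_evaluatesTo (β := β) w).choose
  naturality c d g := by
    ext t
    exact ((t.2.map g.unop).exists_evaluatesTo w).choose_spec.unique
      ((t.2.exists_evaluatesTo w).choose_spec.map g.unop)

lemma evaluatesTo_lift {c : C} (t : (free J f).obj (op c)) :
    t.1.EvaluatesTo β a b ((lift β a b w).app (op c) t) :=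
  (t.2.exists_evaluatesTo w).choose_spec

lemma leaf_lift : leaf J f ≫ lift β a b w = a := by
  ext c x
  exact (evaluatesTo_lift β a b w ((leaf J f).app c x)).unique (.leaf x)

lemma lift_isHom : (alg J f).IsHom β (lift β a b w) b where
  w := by
    ext c t
    exact (evaluatesTo_lift β a b w t).app w
  app_extend {c S y} hS s := by
    by_cases hid : S (𝟙 c)
    · rw [SieveAlg.extend_of_mem_id _ _ _ hid, SieveAlg.extend_of_mem_id _ _ _ hid,
        Family.pushforward_val]
    · rw [alg_extend_of_not_mem hS hid]
      exact (evaluatesTo_lift β a b w _).unique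
        (.node hS _ fun d g hg => evaluatesTo_lift β a b w _)

end Lift

lemma hom_ext {β : SieveAlg J f'} {k k' : free J f ⟶ X'} {b : Y ⟶ Y'}
    (hk : (alg J f).IsHom β k b) (hk' : (alg J f).IsHom β k' b)
    (eq_leaf : leaf J f ≫ k = leaf J f ≫ k') : k = k' := by
  suffices ∀ {c : C} (t : (free J f).obj (op c)), k.app (op c) t = k'.app (op c) t by
    ext c t
    exact this t
  intro c t
  induction t using induction with
  | leaf x => exact congrArg (fun k => k.app (op _) x) eq_leaf
  | node hS hid s ih =>
    rw [← alg_extend_of_not_mem, hk.app_extend, hk'.app_extend]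
    exact β.extend_congr rfl rfl fun g hg _ => ih g hg

/-! ### Functoriality, multiplication and comultiplication -/

variable (J) in
/-- The functoriality of the free extension structure. -/
def map (a : X ⟶ X') (b : Y ⟶ Y') (w : a ≫ f' = f ≫ b) : free J f ⟶ free J f' :=
  lift (alg J f') (a ≫ leaf J f') b (by rw [Category.assoc, leaf_proj, w])

section Map

variable (a : X ⟶ X') (b : Y ⟶ Y') (w : a ≫ f' = f ≫ b)

lemma leaf_map : leaf J f ≫ map J a b w = a ≫ leaf J f' :=
  leaf_lift _ _ _ _

lemma leaf_map_assoc {Z : Cᵒᵖ ⥤ Type u} (k : free J f' ⟶ Z) :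
    leaf J f ≫ map J a b w ≫ k = a ≫ leaf J f' ≫ k := by
  rw [← Category.assoc, leaf_map, Category.assoc]

lemma map_isHom : (alg J f).IsHom (alg J f') (map J a b w) b :=
  lift_isHom _ _ _ _

end Map

lemma map_id : map J (𝟙 X) (𝟙 Y) (f := f) (f' := f) (by simp) = 𝟙 (free J f) :=
  hom_ext (map_isHom _ _ _) (.id _) (by rw [leaf_map]; simp)

lemma map_comp (a : X ⟶ X') (b : Y ⟶ Y') (w : a ≫ f' = f ≫ b) (a' : X' ⟶ X'') (b' : Y' ⟶ Y'')
    (w' : a' ≫ f'' = f' ≫ b') :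
    map J (a ≫ a') (b ≫ b') (by rw [Category.assoc, w', reassoc_of% w]) =
      map J a b w ≫ map J a' b' w' :=
  hom_ext (map_isHom _ _ _) ((map_isHom _ _ _).comp (map_isHom _ _ _))
    (by rw [leaf_map, leaf_map_assoc, leaf_map, Category.assoc])

variable (J f) in
/-- The multiplication of the free algebra monad. -/
def mul : free J (proj J f) ⟶ free J f :=
  lift (alg J f) (𝟙 _) (𝟙 Y) (by simp)

lemma leaf_mul : leaf J (proj J f) ≫ mul J f = 𝟙 _ :=
  leaf_lift _ _ _ _

lemma leaf_mul_assoc {Z : Cᵒᵖ ⥤ Type u} (k : free J f ⟶ Z) :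
    leaf J (proj J f) ≫ mul J f ≫ k = k := by
  rw [← Category.assoc, leaf_mul, Category.id_comp]

lemma mul_isHom : (alg J (proj J f)).IsHom (alg J f) (mul J f) (𝟙 Y) :=
  lift_isHom _ _ _ _

variable (J f) in
/-- The comultiplication of the comonad of left maps, induced by the extension structure on the
composite `free J (leaf J f) ⟶ free J f ⟶ Y`. -/
def comul : free J f ⟶ free J (leaf J f) :=
  lift ((alg J (leaf J f)).comp (alg J f)) (leaf J (leaf J f)) (𝟙 Y)
    (by rw [← Category.assoc, leaf_proj, leaf_proj, Category.comp_id])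

lemma leaf_comul : leaf J f ≫ comul J f = leaf J (leaf J f) :=
  leaf_lift _ _ _ _

lemma leaf_comul_assoc {Z : Cᵒᵖ ⥤ Type u} (k : free J (leaf J f) ⟶ Z) :
    leaf J f ≫ comul J f ≫ k = leaf J (leaf J f) ≫ k := by
  rw [← Category.assoc, leaf_comul]

lemma comul_isHom : (alg J f).IsHom ((alg J (leaf J f)).comp (alg J f)) (comul J f) (𝟙 Y) :=
  lift_isHom _ _ _ _

lemma comul_proj : comul J f ≫ proj J (leaf J f) = 𝟙 _ := by
  refine hom_ext (β := alg J f) (b := 𝟙 Y) ?_ (.id _) ?_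
  · simpa using comul_isHom.comp (SieveAlg.IsHom.comp_right _ _)
  · rw [← Category.assoc, leaf_comul, leaf_proj, Category.comp_id]

lemma map_comul (a : X ⟶ X') (b : Y ⟶ Y') (w : a ≫ f' = f ≫ b) :
    map J a b w ≫ comul J f' = comul J f ≫ map J a (map J a b w) (leaf_map a b w).symm := by
  refine hom_ext (β := (alg J (leaf J f')).comp (alg J f')) (b := b) ?_ ?_ ?_
  · simpa using (map_isHom a b w).comp comul_isHom
  · simpa using comul_isHom.comp ((map_isHom a _ (leaf_map a b w).symm).horizComp
      (map_isHom a b w))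
  · rw [leaf_map_assoc, leaf_comul, leaf_comul_assoc, leaf_map]

lemma map_mul (a : X ⟶ X') (b : Y ⟶ Y') (w : a ≫ f' = f ≫ b) :
    map J (map J a b w) b (map_isHom a b w).w ≫ mul J f' = mul J f ≫ map J a b w := by
  refine hom_ext (β := alg J f') (b := b) ?_ ?_ ?_
  · simpa using (map_isHom _ _ _).comp mul_isHom
  · simpa using mul_isHom.comp (map_isHom a b w)
  · simp only [leaf_map_assoc, leaf_mul, leaf_mul_assoc, Category.comp_id]

lemma map_leaf_mul : map J (leaf J f) (𝟙 Y) (f' := proj J f)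
    (by rw [leaf_proj, Category.comp_id]) ≫ mul J f = 𝟙 _ := by
  refine hom_ext (β := alg J f) (b := 𝟙 Y) ?_ (.id _) ?_
  · simpa using (map_isHom _ _ _).comp mul_isHom
  · rw [← Category.assoc, leaf_map, Category.assoc, leaf_mul]

lemma map_mul_mul :
    map J (mul J f) (𝟙 Y) mul_isHom.w ≫ mul J f = mul J (proj J f) ≫ mul J f := by
  refine hom_ext (β := alg J f) (b := 𝟙 Y) ?_ ?_ ?_
  · simpa using (map_isHom _ _ _).comp mul_isHom
  · simpa using mul_isHom.comp mul_isHom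
  · simp only [leaf_map_assoc, leaf_mul, leaf_mul_assoc, Category.comp_id]

lemma comul_map_proj : comul J f ≫ map J (𝟙 X) (proj J f) (f := leaf J f) (f' := f)
    (by rw [leaf_proj, Category.id_comp]) = 𝟙 _ := by
  refine hom_ext (β := alg J f) (b := 𝟙 Y) ?_ (.id _) ?_
  · simpa using comul_isHom.comp ((map_isHom (𝟙 X) (proj J f) _).comp_over (alg J f))
  · rw [← Category.assoc, leaf_comul, leaf_map, Category.id_comp, Category.comp_id]

lemma comul_map_comul : comul J f ≫ map J (𝟙 X) (comul J f) (f := leaf J f)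
    (f' := leaf J (leaf J f)) (by rw [leaf_comul, Category.id_comp]) =
      comul J f ≫ comul J (leaf J f) := by
  refine hom_ext (β := (alg J (leaf J (leaf J f))).comp ((alg J (leaf J f)).comp (alg J f)))
    (b := 𝟙 Y) ?_ ?_ ?_
  · simpa using comul_isHom.comp ((map_isHom (𝟙 X) (comul J f) _).horizComp comul_isHom)
  · simpa using (comul_isHom.comp (comul_isHom.horizComp (.id (alg J f)))).comp (.assoc _ _ _)
  · rw [leaf_comul_assoc, leaf_comul_assoc, leaf_map, leaf_comul, Category.id_comp]

lemma mul_comul : mul J f ≫ comul J f =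
    comul J (proj J f) ≫ map J (comul J f) (mul J f) (f := leaf J (proj J f))
      (f' := proj J (leaf J f)) (by rw [comul_proj, leaf_mul]) ≫ mul J (leaf J f) := by
  have top_isHom := (map_isHom (comul J f) (mul J f) (f := leaf J (proj J f))
    (f' := proj J (leaf J f)) (by rw [comul_proj, leaf_mul])).comp mul_isHom
  rw [Category.comp_id] at top_isHom
  refine hom_ext (β := (alg J (leaf J f)).comp (alg J f)) (b := 𝟙 Y) ?_ ?_ ?_
  · simpa using mul_isHom.comp comul_isHom
  · simpa using comul_isHom.comp (top_isHom.horizComp mul_isHom)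
  · rw [leaf_mul_assoc, leaf_comul_assoc, leaf_map_assoc, leaf_mul, Category.comp_id]

end free

end Free

namespace StableSieves

open free

variable (J : StableSieves C)

/-- The functorial factorization through free extension structures. -/
def fact : FunctorialFactorization (Cᵒᵖ ⥤ Type u) where
  Z :=
    { obj := fun f => free J f.hom
      map := fun sq => map J sq.left sq.right (Arrow.w sq)
      map_id := fun _ => map_id
      map_comp := fun _ _ => map_comp _ _ _ _ _ _ }
  i :=
    { app := fun f => leaf J f.hom
      naturality := fun _ _ sq => (leaf_map sq.left sq.right (Arrow.w sq)).symm }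
  p :=
    { app := fun f => proj J f.hom
      naturality := fun _ _ sq => (map_isHom sq.left sq.right (Arrow.w sq)).w }
  fac := by
    ext f : 2
    exact leaf_proj J f.hom
  hi _ := trivial
  hp _ := trivial

/-- The factorization through free extension structures, with its comonad and monad structure. -/
def preAWFS : PreAWFS (Cᵒᵖ ⥤ Type u) where
  fact := J.fact
  comul :=
    { app := fun f => Arrow.homMk (f := J.fact.L.obj f) (g := J.fact.L.obj (J.fact.L.obj f))
        (u := 𝟙 f.left) (v := comul J f.hom) ((Category.id_comp _).trans leaf_comul.symm)
      naturality := fun f g sq => by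
        ext1
        · exact (Category.comp_id _).trans (Category.id_comp _).symm
        · exact map_comul sq.left sq.right (Arrow.w sq) }
  mul :=
    { app := fun f => Arrow.homMk (f := J.fact.R.obj (J.fact.R.obj f)) (g := J.fact.R.obj f)
        (u := mul J f.hom) (v := 𝟙 f.right) mul_isHom.w
      naturality := fun f g sq => by
        ext1
        · exact map_mul sq.left sq.right (Arrow.w sq)
        · exact (Category.comp_id _).trans (Category.id_comp _).symm }
  coassoc f := by
    ext1
    · rfl
    · exact comul_map_comul
  left_counit f := by
    ext1
    · exact Category.id_comp _
    · exact comul_proj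
  right_counit f := by
    ext1
    · exact Category.id_comp _
    · exact comul_map_proj
  assoc f := by
    ext1
    · exact map_mul_mul
    · rfl
  left_unit f := by
    ext1
    · exact leaf_mul
    · exact Category.id_comp _
  right_unit f := by
    ext1
    · exact map_leaf_mul
    · exact Category.id_comp _

/-- The algebraic weak factorization system whose right maps are the maps with an extension
structure for the sieves in `J`. -/
def awfs : AWFS (Cᵒᵖ ⥤ Type u) where
  toPreAWFS := J.preAWFS
  distrib :=
    { unit := fun _ => Arrow.hom_ext _ _ leaf_comul map_leaf_mul
      counit := fun _ => Arrow.hom_ext _ _ comul_map_proj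
        (mul_isHom.w.trans (Category.comp_id _))
      mul := fun f => Arrow.hom_ext _ _ mul_comul
        (map_mul_mul.trans (congrArg (mul J _ ≫ ·) (Category.comp_id (mul J f.hom)).symm))
      comul := fun f => Arrow.hom_ext _ _
        (comul_map_comul.trans (Category.id_comp (comul J f.hom ≫ comul J (leaf J f.hom))).symm)
        mul_comul }

end StableSieves

/-! ### Fillers against monomorphisms -/

section Squares

variable {A B X Y : Cᵒᵖ ⥤ Type u} {m m' f f' : Arrow (Cᵒᵖ ⥤ Type u)}

lemma isPullback_iff_elementwise {t : A ⟶ X} {l : A ⟶ B} {r : X ⟶ Y} {b : B ⟶ Y} :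
    IsPullback t l r b ↔ t ≫ r = l ≫ b ∧ ∀ c : C,
      (∀ x y : A.obj (op c), t.app _ x = t.app _ y → l.app _ x = l.app _ y → x = y) ∧
      ∀ (x : X.obj (op c)) (y : B.obj (op c)), r.app _ x = b.app _ y →
        ∃ z, t.app _ z = x ∧ l.app _ z = y := by
  simp only [IsPullback.iff_app, Types.isPullback_iff]
  constructor
  · intro h
    refine ⟨?_, fun c => ⟨fun x y h₁ h₂ => (h (op c)).2.1 x y ⟨h₁, h₂⟩, (h (op c)).2.2⟩⟩
    ext c : 2
    exact (h c).1
  · rintro ⟨w, h⟩ c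
    exact ⟨congrArg (fun t => t.app c) w, fun x y ⟨h₁, h₂⟩ => (h c.unop).1 x y h₁ h₂,
      (h c.unop).2⟩

/-- The inclusion of a sieve into the representable presheaf, as an arrow. -/
abbrev sieveArrow {c : C} (S : Sieve c) : Arrow (Cᵒᵖ ⥤ Type u) :=
  Arrow.mk S.functorInclusion

lemma imageSieve_functorInclusion {c d : C} (S : Sieve c) (g : d ⟶ c) :
    Presheaf.imageSieve (U := d) S.functorInclusion g = S.pullback g := by
  ext e k
  constructor
  · rintro ⟨⟨a, ha⟩, h⟩
    obtain rfl : a = k ≫ g := h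
    exact ha
  · intro h
    exact ⟨⟨k ≫ g, h⟩, rfl⟩

lemma imageSieve_app_of_cartesian {σ : m' ⟶ m} (hσ : cartesianSquares _ σ) {c : C}
    (b : m'.right.obj (op c)) :
    Presheaf.imageSieve m.hom (σ.right.app (op c) b) = Presheaf.imageSieve m'.hom b := by
  ext d g
  obtain ⟨w, h⟩ := isPullback_iff_elementwise.1 hσ
  constructor
  · rintro ⟨a, ha⟩
    obtain ⟨z, -, hz⟩ := (h d).2 a (m'.right.map g.op b) (by rw [ha, NatTrans.naturality_apply])
    exact ⟨z, hz⟩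
  · rintro ⟨a, ha⟩
    refine ⟨σ.left.app _ a, ?_⟩
    rw [← NatTrans.naturality_apply, ← ha, ← NatTrans.comp_app_apply, w, NatTrans.comp_app_apply]

lemma localPreimage_eq (m : A ⟶ B) [Mono m] {c d : C} (b : B.obj (op c)) (g : d ⟶ c)
    (hg : Presheaf.imageSieve m b g) {a : A.obj (op d)} (h : m.app (op d) a = B.map g.op b) :
    Presheaf.localPreimage (U := op c) m b g hg = a :=
  (mono_iff_injective (m.app (op d))).1 inferInstance
    ((Presheaf.app_localPreimage (U := op c) m b g hg).trans h.symm)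

lemma map_localPreimage (m : A ⟶ B) [Mono m] {c d e : C} (b : B.obj (op c)) (g : d ⟶ c)
    (hg : Presheaf.imageSieve m b g) (k : e ⟶ d) :
    A.map k.op (Presheaf.localPreimage (U := op c) m b g hg) =
      Presheaf.localPreimage (U := op c) m b (k ≫ g) (Sieve.downward_closed _ hg k) := by
  refine (localPreimage_eq m b _ _ ?_).symm
  rw [NatTrans.naturality_apply, Presheaf.app_localPreimage]
  simp

/-- The square from the inclusion of the image sieve of `b` to the monomorphism `m` that is given
by `b` on codomains. -/
def imageSieveSquare (m : Arrow (Cᵒᵖ ⥤ Type u)) [Mono m.hom] {c : C} (b : m.right.obj (op c)) :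
    sieveArrow (Presheaf.imageSieve m.hom b) ⟶ m :=
  Arrow.homMk (f := sieveArrow _) (g := m)
    (u := { app := fun d => TypeCat.ofHom fun g =>
              Presheaf.localPreimage (U := op c) m.hom b g.1 g.2
            naturality := fun d e k => by
              ext g
              exact (map_localPreimage m.hom b g.1 g.2 k.unop).symm })
    (v := yonedaEquiv.symm b) (by
      ext d g
      exact Presheaf.app_localPreimage (U := op c) m.hom b g.1 g.2)

lemma imageSieveSquare_cartesian (m : Arrow (Cᵒᵖ ⥤ Type u)) [Mono m.hom] {c : C}
    (b : m.right.obj (op c)) : cartesianSquares _ (imageSieveSquare m b) := by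
  refine isPullback_iff_elementwise.2
    ⟨Arrow.w (imageSieveSquare m b), fun d => ⟨fun x y _ h => Subtype.ext h, fun x y h => ?_⟩⟩
  exact ⟨⟨y, x, h⟩, localPreimage_eq m.hom b y ⟨x, h⟩ h, rfl⟩

/-- The arrows that are monomorphisms and all of whose image sieves are in `J`: those against which
an extension structure for `J` has fillers. -/
structure StableSieves.Classifies (J : StableSieves C) (m : Arrow (Cᵒᵖ ⥤ Type u)) : Prop where
  mono : Mono m.hom
  imageSieve_mem : ∀ {c : C} (b : m.right.obj (op c)), J.mem (Presheaf.imageSieve m.hom b)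

lemma StableSieves.classifies_sieveArrow {J : StableSieves C} {c : C} {S : Sieve c}
    (hS : J.mem S) : J.Classifies (sieveArrow S) where
  mono := inferInstanceAs (Mono S.functorInclusion)
  imageSieve_mem g := by
    exact (imageSieve_functorInclusion S g).symm ▸ J.pullback_mem g hS

namespace Family

/-- The family of an element of the codomain of a monomorphism, given by a square. -/
def ofSquare [Mono m.hom] (sq : m ⟶ f) {c : C} (b : m.right.obj (op c)) :
    Family f.hom (Presheaf.imageSieve m.hom b) (sq.right.app (op c) b) where
  val g hg := sq.left.app _ (Presheaf.localPreimage (U := op c) m.hom b g hg)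
  map_val g hg k := by rw [← NatTrans.naturality_apply, map_localPreimage]
  app_val g hg := by
    rw [← NatTrans.comp_app_apply, Arrow.w sq, NatTrans.comp_app_apply,
      Presheaf.app_localPreimage (U := op c), NatTrans.naturality_apply]

/-- The square from the inclusion of the indexing sieve that corresponds to a family. -/
def square {c : C} {S : Sieve c} {y : f.right.obj (op c)} (s : Family f.hom S y) :
    sieveArrow S ⟶ f :=
  Arrow.homMk (f := sieveArrow S) (g := f)
    (u := { app := fun d => TypeCat.ofHom fun g => s.val g.1 g.2
            naturality := fun d d' k => by
              ext g
              exact (s.map_val g.1 g.2 k.unop).symm })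
    (v := yonedaEquiv.symm y) (by
      ext d g
      exact s.app_val g.1 g.2)

end Family

namespace SieveAlg

variable {J : StableSieves C}

/-- The filler, determined by an extension structure, of a square from an arrow classified by
`J`. -/
def fill (α : SieveAlg J f.hom) (hm : J.Classifies m) (sq : m ⟶ f) : m.right ⟶ f.left :=
  have := hm.mono
  { app := fun c => TypeCat.ofHom fun b =>
      α.extend (hm.imageSieve_mem (c := c.unop) b) (Family.ofSquare sq b)
    naturality := fun c d g => by
      ext b
      refine Eq.trans ?_ (α.map_extend (hm.imageSieve_mem (c := c.unop) b) (Family.ofSquare sq b)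
        g.unop).symm
      refine α.extend_congr (Presheaf.pullback_imageSieve (U := c.unop) m.hom b g.unop).symm
        (NatTrans.naturality_apply sq.right g b) fun {e} k hk hk' => ?_
      refine congrArg (sq.left.app (op e)) (localPreimage_eq m.hom _ k hk ?_)
      refine (Presheaf.app_localPreimage (U := c) m.hom b (k ≫ g.unop)
        ((Sieve.pullback_apply _ _ _ _).mp hk')).trans ?_
      exact congrArg (fun t => t b) (m.right.map_comp g k.op) }

lemma hom_fill (α : SieveAlg J f.hom) (hm : J.Classifies m) (sq : m ⟶ f) :
    m.hom ≫ α.fill hm sq = sq.left := by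
  have := hm.mono
  ext c a
  have map_id_app : m.hom.app c a = m.right.map (𝟙 c.unop).op (m.hom.app c a) := by simp
  refine (α.extend_of_mem_id (hm.imageSieve_mem (c := c.unop) _) _ ⟨a, map_id_app⟩).trans ?_
  exact congrArg (sq.left.app c) (localPreimage_eq m.hom _ (𝟙 c.unop) _ map_id_app)

lemma fill_hom (α : SieveAlg J f.hom) (hm : J.Classifies m) (sq : m ⟶ f) :
    α.fill hm sq ≫ f.hom = sq.right := by
  ext c b
  exact α.app_extend _ _

lemma right_comp_fill (α : SieveAlg J f.hom) (hm : J.Classifies m) (hm' : J.Classifies m')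
    {σ : m' ⟶ m} (hσ : cartesianSquares _ σ) (sq : m ⟶ f) :
    σ.right ≫ α.fill hm sq = α.fill hm' (σ ≫ sq) := by
  have := hm.mono
  have := hm'.mono
  ext c b
  refine α.extend_congr (imageSieve_app_of_cartesian (c := c.unop) hσ b) rfl
    fun {d} g hg hg' => congrArg (sq.left.app (op d)) (localPreimage_eq m.hom _ g hg ?_)
  set a := Presheaf.localPreimage (U := c) m'.hom b g hg' with ha
  calc m.hom.app (op d) (σ.left.app (op d) a)
    _ = σ.right.app (op d) (m'.hom.app (op d) a) := by
      rw [← NatTrans.comp_app_apply, Arrow.w σ, NatTrans.comp_app_apply]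
    _ = m.right.map g.op (σ.right.app c b) := by
      rw [ha, Presheaf.app_localPreimage (U := c)]
      exact NatTrans.naturality_apply σ.right g.op b

lemma IsHom.fill_comp {α : SieveAlg J f.hom} {β : SieveAlg J f'.hom} {τ : f ⟶ f'}
    (h : IsHom α β τ.left τ.right) (hm : J.Classifies m) (sq : m ⟶ f) :
    α.fill hm sq ≫ τ.left = β.fill hm (sq ≫ τ) := by
  ext c b
  refine (h.app_extend _ _).trans ?_
  exact β.extend_congr rfl rfl fun _ _ _ => rfl

lemma yonedaEquiv_fill_square (α : SieveAlg J f.hom) {c : C} {S : Sieve c} (hS : J.mem S)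
    {y : f.right.obj (op c)} (s : Family f.hom S y) :
    yonedaEquiv (α.fill (J.classifies_sieveArrow hS) s.square) = α.extend hS s := by
  have := (J.classifies_sieveArrow hS).mono
  refine α.extend_congr ((imageSieve_functorInclusion S (𝟙 c)).trans S.pullback_id)
    (yonedaEquiv.apply_symm_apply y) fun {d} g hg hg' => ?_
  exact congrArg (s.square.left.app (op d))
    (localPreimage_eq S.functorInclusion (𝟙 c) g hg (a := ⟨g, hg'⟩) (Category.comp_id g).symm)

end SieveAlg

end Squares

/-! ### Algebras for the monad as extension structures -/

section IsoOver

variable {B : Type u} [Category.{v} B] {J : Type u₁} [Category.{v₁} J] {K : Type u₂}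
  [Category.{v₂} K]

lemma functor_eq_of_comp_faithful (V : K ⥤ B) [V.Faithful] {P Q : J ⥤ K}
    (hobj : ∀ j, P.obj j = Q.obj j) (h : P ⋙ V = Q ⋙ V) : P = Q :=
  CategoryTheory.Functor.ext hobj fun j k f => V.map_injective <| by
    simpa [eqToHom_map] using Functor.congr_hom h f

lemma IsoOver.of_obj {U : J ⥤ B} {V : K ⥤ B} [U.Faithful] [V.Faithful] (F : J ⥤ K) (G : K ⥤ J)
    (hF : F ⋙ V = U) (hG : G ⋙ U = V) (hGF : ∀ j, G.obj (F.obj j) = j)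
    (hFG : ∀ k, F.obj (G.obj k) = k) : IsoOver U V :=
  ⟨F, G, functor_eq_of_comp_faithful U hGF (by rw [Functor.assoc, hG, hF, Functor.id_comp]),
    functor_eq_of_comp_faithful V hFG (by rw [Functor.assoc, hF, hG, Functor.id_comp]), hF⟩

lemma IsoOver.trans {L : Type*} [Category* L] {U : J ⥤ B} {V : K ⥤ B} {W : L ⥤ B}
    (h : IsoOver U V) (h' : IsoOver V W) : IsoOver U W := by
  obtain ⟨F, G, hFG, hGF, hF⟩ := h
  obtain ⟨F', G', hFG', hGF', hF'⟩ := h'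
  refine ⟨F ⋙ F', G' ⋙ G, ?_, ?_, ?_⟩
  · rw [Functor.assoc, ← Functor.assoc F' G' G, hFG', Functor.id_comp, hFG]
  · rw [Functor.assoc, ← Functor.assoc G F F', hGF, Functor.id_comp, hGF']
  · rw [Functor.assoc, hF', hF]

end IsoOver

/-- An arrow with an extension structure for the sieves in `J`. -/
structure SieveAlgCat (J : StableSieves C) where
  /-- the underlying arrow -/
  arrow : Arrow (Cᵒᵖ ⥤ Type u)
  /-- the extension structure -/
  alg : SieveAlg J arrow.hom

namespace SieveAlgCat

variable {J : StableSieves C}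

/-- A square that preserves the chosen extensions. -/
@[ext]
structure Hom (f g : SieveAlgCat J) where
  /-- the underlying square -/
  sq : f.arrow ⟶ g.arrow
  isHom : f.alg.IsHom g.alg sq.left sq.right

instance : Category (SieveAlgCat J) where
  Hom := Hom
  id f := ⟨𝟙 f.arrow, .id _⟩
  comp α β := ⟨α.sq ≫ β.sq, α.isHom.comp β.isHom⟩

variable (J) in
/-- The functor that forgets the extension structure. -/
def forget : SieveAlgCat J ⥤ Arrow (Cᵒᵖ ⥤ Type u) where
  obj f := f.arrow
  map α := Hom.sq α

instance : (forget J).Faithful where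
  map_injective h := Hom.ext h

end SieveAlgCat

namespace SieveAlg

variable {J : StableSieves C} {X Y Z X' Y' Z' : Cᵒᵖ ⥤ Type u} {f : X ⟶ Y} {g : Z ⟶ Y}
  {f' : X' ⟶ Y'} {g' : Z' ⟶ Y'} (α : SieveAlg J g) {β : SieveAlg J g'}

/-- The extension structure on a retract over the base. -/
def retract (i : X ⟶ Z) (r : Z ⟶ X) (hi : i ≫ g = f ≫ 𝟙 Y) (hr : r ≫ f = g ≫ 𝟙 Y)
    (hir : i ≫ r = 𝟙 X) : SieveAlg J f where
  extend hS s := r.app _ (α.extend hS (s.pushforward i (𝟙 Y) hi))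
  app_extend hS s := by
    rw [← NatTrans.comp_app_apply, hr, NatTrans.comp_app_apply, α.app_extend]
    rfl
  map_extend_of_mem hS s d k hk := by
    rw [← NatTrans.naturality_apply, α.map_extend_of_mem _ _ k hk, Family.pushforward_val,
      ← NatTrans.comp_app_apply, hir]
    rfl
  map_extend hS s d k := by
    rw [← NatTrans.naturality_apply, α.map_extend]
    exact congrArg (r.app _) (α.extend_congr rfl rfl fun _ _ _ => rfl)

variable {α}

lemma IsHom.retract {i : X ⟶ Z} {r : Z ⟶ X} {hi : i ≫ g = f ≫ 𝟙 Y} {hr : r ≫ f = g ≫ 𝟙 Y}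
    {hir : i ≫ r = 𝟙 X} {i' : X' ⟶ Z'} {r' : Z' ⟶ X'} {hi' : i' ≫ g' = f' ≫ 𝟙 Y'}
    {hr' : r' ≫ f' = g' ≫ 𝟙 Y'} {hir' : i' ≫ r' = 𝟙 X'} {a : X ⟶ X'} {k : Z ⟶ Z'}
    {b : Y ⟶ Y'} (h : α.IsHom β k b) (w : a ≫ f' = f ≫ b) (hk : i ≫ k = a ≫ i')
    (hk' : k ≫ r' = r ≫ a) :
    (α.retract i r hi hr hir).IsHom (β.retract i' r' hi' hr' hir') a b where
  w := w
  app_extend {c S y} hS s := by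
    change a.app _ (r.app _ _) = r'.app _ _
    rw [← NatTrans.comp_app_apply, ← hk', NatTrans.comp_app_apply, h.app_extend]
    refine congrArg (r'.app (op c)) (β.extend_congr rfl rfl fun {d} l hl _ => ?_)
    exact congrArg (fun t => t.app (op d) (s.val l hl)) hk

lemma IsHom.retract_eq {α' : SieveAlg J f} {i : X ⟶ Z} {r : Z ⟶ X} (h : α.IsHom α' r (𝟙 Y))
    (hi : i ≫ g = f ≫ 𝟙 Y) (hir : i ≫ r = 𝟙 X) : α.retract i r hi h.w hir = α' := by
  ext c S y hS s
  refine (h.app_extend hS _).trans (α'.extend_congr rfl rfl fun {d} k hk _ => ?_)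
  exact congrArg (fun t => t.app (op d) (s.val k hk)) hir

end SieveAlg

namespace free

variable {J : StableSieves C} {X Y X' Y' : Cᵒᵖ ⥤ Type u} {f : X ⟶ Y} {f' : X' ⟶ Y'}

/-- The action of the free algebra monad on a map with an extension structure. -/
def action (α : SieveAlg J f) : free J f ⟶ X :=
  lift α (𝟙 X) (𝟙 Y) (by simp)

lemma leaf_action (α : SieveAlg J f) : leaf J f ≫ action α = 𝟙 X :=
  leaf_lift _ _ _ _

lemma action_isHom (α : SieveAlg J f) : (alg J f).IsHom α (action α) (𝟙 Y) :=
  lift_isHom _ _ _ _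

lemma map_action {α : SieveAlg J f} {β : SieveAlg J f'} {a : X ⟶ X'} {b : Y ⟶ Y'}
    (h : α.IsHom β a b) : map J a b h.w ≫ action β = action α ≫ a := by
  refine hom_ext (β := β) (b := b) ?_ ?_ ?_
  · simpa using (map_isHom _ _ h.w).comp (action_isHom β)
  · simpa using (action_isHom α).comp h
  · rw [leaf_map_assoc, leaf_action, reassoc_of% leaf_action α, Category.comp_id]

end free

namespace StableSieves

open free

variable {J : StableSieves C}

lemma algebra_a_right (A : J.awfs.TrivFib) : A.a.right = 𝟙 A.A.right :=
  (Category.id_comp _).symm.trans (congrArg CommaMorphism.right A.unit)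

/-- The extension structure of a monad algebra, which is a retract of the free one. -/
def algOfAlgebra (A : J.awfs.TrivFib) : SieveAlg J A.A.hom :=
  (alg J A.A.hom).retract (leaf J A.A.hom) A.a.left
    ((leaf_proj J A.A.hom).trans (Category.comp_id _).symm)
    ((Arrow.w A.a).trans (congrArg (_ ≫ ·) (algebra_a_right A)))
    (congrArg CommaMorphism.left A.unit)

lemma algOfAlgebra_isHom {A B : J.awfs.TrivFib} (φ : A ⟶ B) :
    (algOfAlgebra A).IsHom (algOfAlgebra B) φ.f.left φ.f.right :=
  (map_isHom φ.f.left φ.f.right (Arrow.w φ.f)).retract (Arrow.w φ.f) (leaf_map _ _ _)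
    (congrArg CommaMorphism.left φ.h)

lemma algebra_a_isHom (A : J.awfs.TrivFib) :
    (alg J A.A.hom).IsHom (algOfAlgebra A) A.a.left (𝟙 _) := by
  have algOfAlgebra_free : algOfAlgebra (J.awfs.monad.free.obj A.A) = alg J A.A.hom :=
    mul_isHom.retract_eq _ leaf_mul
  let a : J.awfs.monad.free.obj A.A ⟶ A := ⟨A.a, A.assoc.symm⟩
  have isHom := algOfAlgebra_isHom a
  rw [algOfAlgebra_free] at isHom
  exact algebra_a_right A ▸ isHom

/-- The monad algebra given by an extension structure. -/
def algebraOfAlg (f : SieveAlgCat J) : J.awfs.TrivFib where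
  A := f.arrow
  a := Arrow.homMk (f := J.fact.R.obj f.arrow) (g := f.arrow)
    (u := action f.alg) (v := 𝟙 f.arrow.right) (action_isHom f.alg).w
  unit := by
    ext1
    · exact leaf_action f.alg
    · exact Category.id_comp (𝟙 f.arrow.right)
  assoc := by
    ext1
    · exact (map_action (action_isHom f.alg)).symm
    · rfl

variable (J) in
/-- The functor from monad algebras to maps with an extension structure. -/
def toSieveAlgCat : J.awfs.TrivFib ⥤ SieveAlgCat J where
  obj A := ⟨A.A, algOfAlgebra A⟩
  map φ := ⟨φ.f, algOfAlgebra_isHom φ⟩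

variable (J) in
/-- The functor from maps with an extension structure to monad algebras. -/
def ofSieveAlgCat : SieveAlgCat J ⥤ J.awfs.TrivFib where
  obj f := algebraOfAlg f
  map φ :=
    { f := φ.sq
      h := by
        ext1
        · exact map_action φ.isHom
        · exact (Category.comp_id φ.sq.right).trans (Category.id_comp φ.sq.right).symm }

lemma algebra_eq_of_a_eq {E : Type*} [Category* E] {T : Monad E} {X : E} {a a' : T.obj X ⟶ X}
    (h : a = a') {hu : T.η.app X ≫ a = 𝟙 X} {hu' : T.η.app X ≫ a' = 𝟙 X}
    {ha : T.μ.app X ≫ a = T.map a ≫ a} {ha' : T.μ.app X ≫ a' = T.map a' ≫ a'} :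
    Monad.Algebra.mk X a hu ha = Monad.Algebra.mk X a' hu' ha' := by
  subst h
  rfl

lemma algebraOfAlg_algOfAlgebra (A : J.awfs.TrivFib) :
    algebraOfAlg ⟨A.A, algOfAlgebra A⟩ = A := by
  have a_eq : (algebraOfAlg ⟨A.A, algOfAlgebra A⟩).a = A.a := by
    ext1
    · exact hom_ext (action_isHom _) (algebra_a_isHom A)
        ((leaf_action _).trans (congrArg CommaMorphism.left A.unit).symm)
    · exact (algebra_a_right A).symm
  exact algebra_eq_of_a_eq a_eq

lemma algOfAlgebra_algebraOfAlg (f : SieveAlgCat J) : algOfAlgebra (algebraOfAlg f) = f.alg :=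
  (action_isHom f.alg).retract_eq _ _

lemma isoOver_sieveAlgCat : IsoOver J.awfs.trivFibForget (SieveAlgCat.forget J) :=
  .of_obj J.toSieveAlgCat J.ofSieveAlgCat rfl rfl algebraOfAlg_algOfAlgebra
    fun f => congrArg (SieveAlgCat.mk f.arrow) (algOfAlgebra_algebraOfAlg f)

end StableSieves

/-! ### Right maps as extension structures -/

section RightMaps

/-- The square from the inclusion of a pulled back sieve to the inclusion of the sieve. -/
def sievePullback {c d : C} (S : Sieve c) (g : d ⟶ c) : sieveArrow (S.pullback g) ⟶ sieveArrow S :=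
  Arrow.homMk (f := sieveArrow (S.pullback g)) (g := sieveArrow S)
    (u := { app := fun e => TypeCat.ofHom fun k =>
              ⟨k.1 ≫ g, (Sieve.pullback_apply _ _ _ _).mp k.2⟩
            naturality := fun e e' l => by
              ext k
              exact Subtype.ext (Category.assoc _ _ _) })
    (v := yoneda.map g) rfl

lemma sievePullback_cartesian {c d : C} (S : Sieve c) (g : d ⟶ c) :
    cartesianSquares _ (sievePullback S g) := by
  refine isPullback_iff_elementwise.2
    ⟨rfl, fun e => ⟨fun x y _ h => Subtype.ext h, fun x y (h : x.1 = y ≫ g) => ?_⟩⟩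
  have comp_mem : S (y ≫ g) := h ▸ x.2
  exact ⟨⟨y, comp_mem⟩, Subtype.ext h.symm, rfl⟩

namespace Family

variable {f f' : Arrow (Cᵒᵖ ⥤ Type u)} {c d : C} {S : Sieve c} {y : f.right.obj (op c)}

lemma square_restrict (s : Family f.hom S y) (g : d ⟶ c) :
    (s.restrict g).square = sievePullback S g ≫ s.square := by
  ext1
  · rfl
  · exact (yonedaEquiv_symm_naturality_left g _ y).symm

lemma square_pushforward (s : Family f.hom S y) (τ : f ⟶ f') :
    (s.pushforward τ.left τ.right (Arrow.w τ)).square = s.square ≫ τ := by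
  ext1
  · rfl
  · exact (yonedaEquiv_symm_naturality_right _ τ.right y).symm

lemma square_ofSquare {m : Arrow (Cᵒᵖ ⥤ Type u)} [Mono m.hom] (sq : m ⟶ f)
    (b : m.right.obj (op c)) : (ofSquare sq b).square = imageSieveSquare m b ≫ sq := by
  ext1
  · rfl
  · exact (yonedaEquiv_symm_naturality_right _ sq.right b).symm

end Family

lemma cartesianSquares_of_isIso {E : Type*} [Category* E] {f g : Arrow E} (σ : f ⟶ g) [IsIso σ] :
    cartesianSquares _ σ :=
  IsPullback.of_horiz_isIso ⟨Arrow.w σ⟩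

/-- A category of arrows classified by `J` and of all the pullback squares between them that
contains, up to isomorphism, the inclusions of all sieves in `J`. Right maps against it are the
same as arrows with an extension structure. -/
structure SieveDense (J : StableSieves C) {I : Type u₁} [Category.{v₁} I]
    (U : I ⥤ Arrow (Cᵒᵖ ⥤ Type u)) where
  classifies : ∀ i, J.Classifies (U.obj i)
  cartesian : ∀ {i j : I} (σ : i ⟶ j), cartesianSquares _ (U.map σ)
  full : ∀ {i j : I} (sq : U.obj i ⟶ U.obj j), cartesianSquares _ sq → ∃ σ, U.map σ = sq
  /-- the object corresponding to a sieve -/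
  obj : ∀ {c : C} {S : Sieve c}, J.mem S → I
  /-- the isomorphism with the inclusion of the sieve -/
  iso : ∀ {c : C} {S : Sieve c} (hS : J.mem S), U.obj (obj hS) ≅ sieveArrow S

namespace SieveDense

variable {J : StableSieves C} {I : Type u₁} [Category.{v₁} I] {U : I ⥤ Arrow (Cᵒᵖ ⥤ Type u)}
  (D : SieveDense J U)

/-- The right map given by an extension structure. -/
def rightMapOfAlg (f : SieveAlgCat J) : RightMap U where
  arrow := f.arrow
  lift i sq := f.alg.fill (D.classifies i) sq
  fac_left i sq := f.alg.hom_fill (D.classifies i) sq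
  fac_right i sq := f.alg.fill_hom (D.classifies i) sq
  naturality σ sq := f.alg.right_comp_fill (D.classifies _) (D.classifies _) (D.cartesian σ) sq

/-- The functor from arrows with an extension structure to right maps. -/
def toRightMap : SieveAlgCat J ⥤ RightMap U where
  obj f := D.rightMapOfAlg f
  map φ := ⟨φ.sq, fun i sq => φ.isHom.fill_comp (D.classifies i) sq⟩

variable {c d : C} {S : Sieve c}

/-- The filler of a square from the inclusion of a sieve to a right map. -/
def sieveLift (r : RightMap U) (hS : J.mem S) (sq : sieveArrow S ⟶ r.arrow) :
    yoneda.obj c ⟶ r.arrow.left :=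
  (D.iso hS).inv.right ≫ r.lift (D.obj hS) ((D.iso hS).hom ≫ sq)

lemma right_comp_lift (r : RightMap U) (hS : J.mem S) {i : I} {σ : sieveArrow S ⟶ U.obj i}
    (hσ : cartesianSquares _ σ) (sq : U.obj i ⟶ r.arrow) :
    σ.right ≫ r.lift i sq = D.sieveLift r hS (σ ≫ sq) := by
  obtain ⟨τ, hτ⟩ := D.full ((D.iso hS).hom ≫ σ)
    ((cartesianSquares _).comp_mem _ _ (cartesianSquares_of_isIso _) hσ)
  have naturality_τ := r.naturality τ sq
  rw [hτ, Category.assoc] at naturality_τ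
  rw [sieveLift, ← naturality_τ, ← Category.assoc, ← Arrow.comp_right, Iso.inv_hom_id_assoc]

lemma hom_sieveLift (r : RightMap U) (hS : J.mem S) (sq : sieveArrow S ⟶ r.arrow) :
    S.functorInclusion ≫ D.sieveLift r hS sq = sq.left := by
  have w : (D.iso hS).inv.left ≫ (U.obj _).hom = S.functorInclusion ≫ (D.iso hS).inv.right :=
    Arrow.w (D.iso hS).inv
  rw [sieveLift, ← Category.assoc, ← w, Category.assoc, r.fac_left, ← Arrow.comp_left,
    Iso.inv_hom_id_assoc]

lemma sieveLift_hom (r : RightMap U) (hS : J.mem S) (sq : sieveArrow S ⟶ r.arrow) :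
    D.sieveLift r hS sq ≫ r.arrow.hom = sq.right := by
  rw [sieveLift, Category.assoc, r.fac_right, ← Arrow.comp_right, Iso.inv_hom_id_assoc]

lemma yonedaMap_comp_sieveLift (r : RightMap U) (hS : J.mem S) (g : d ⟶ c)
    (sq : sieveArrow S ⟶ r.arrow) :
    yoneda.map g ≫ D.sieveLift r hS sq =
      D.sieveLift r (J.pullback_mem g hS) (sievePullback S g ≫ sq) := by
  have lift_iso := D.right_comp_lift r (J.pullback_mem g hS)
    ((cartesianSquares _).comp_mem _ _ (sievePullback_cartesian S g)
      (cartesianSquares_of_isIso (D.iso hS).inv)) ((D.iso hS).hom ≫ sq)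
  rw [Category.assoc, Iso.inv_hom_id_assoc, Arrow.comp_right, Category.assoc] at lift_iso
  exact lift_iso

lemma sieveLift_comp {r r' : RightMap U} (φ : r ⟶ r') (hS : J.mem S)
    (sq : sieveArrow S ⟶ r.arrow) :
    D.sieveLift r hS sq ≫ φ.sq.left = D.sieveLift r' hS (sq ≫ φ.sq) := by
  rw [sieveLift, Category.assoc, φ.lift_comp, Category.assoc]
  rfl

/-- The extension structure of a right map. -/
def algOfRightMap (r : RightMap U) : SieveAlg J r.arrow.hom where
  extend hS s := yonedaEquiv (D.sieveLift r hS s.square)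
  app_extend hS s := by
    rw [← yonedaEquiv_comp, sieveLift_hom]
    exact yonedaEquiv.apply_symm_apply _
  map_extend_of_mem hS s d g hg := by
    rw [map_yonedaEquiv]
    exact congrArg (fun t => t.app (op d) ⟨g, hg⟩) (D.hom_sieveLift r hS s.square)
  map_extend hS s d g := by
    rw [yonedaEquiv_naturality, yonedaMap_comp_sieveLift, Family.square_restrict]

/-- The functor from right maps to arrows with an extension structure. -/
def ofRightMap : RightMap U ⥤ SieveAlgCat J where
  obj r := ⟨r.arrow, D.algOfRightMap r⟩
  map {r r'} φ :=
    { sq := φ.sq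
      isHom :=
        { w := Arrow.w φ.sq
          app_extend := fun hS s => by
            refine (yonedaEquiv_comp (D.sieveLift r hS s.square) φ.sq.left).symm.trans ?_
            rw [sieveLift_comp, ← Family.square_pushforward]
            rfl } }

lemma algOfRightMap_rightMapOfAlg (f : SieveAlgCat J) :
    D.algOfRightMap (D.rightMapOfAlg f) = f.alg := by
  ext c S y hS s
  have fill_iso (sq : sieveArrow S ⟶ f.arrow) : (D.iso hS).inv.right ≫
      f.alg.fill (D.classifies (D.obj hS)) ((D.iso hS).hom ≫ sq) =
      f.alg.fill (J.classifies_sieveArrow hS) sq := by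
    rw [f.alg.right_comp_fill (D.classifies (D.obj hS)) (J.classifies_sieveArrow hS)
      (cartesianSquares_of_isIso (D.iso hS).inv), Iso.inv_hom_id_assoc]
  exact (congrArg yonedaEquiv (fill_iso s.square)).trans (f.alg.yonedaEquiv_fill_square hS s)

lemma rightMapOfAlg_algOfRightMap_lift (r : RightMap U) (i : I) (sq : U.obj i ⟶ r.arrow) :
    (D.rightMapOfAlg ⟨r.arrow, D.algOfRightMap r⟩).lift i sq = r.lift i sq := by
  have := (D.classifies i).mono
  ext c b
  have hS := (D.classifies i).imageSieve_mem (c := c.unop) b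
  calc yonedaEquiv (D.sieveLift r hS (Family.ofSquare sq b).square)
    _ = yonedaEquiv (yonedaEquiv.symm b ≫ r.lift i sq) := by
      rw [Family.square_ofSquare, ← D.right_comp_lift r hS (imageSieveSquare_cartesian _ b)]
      rfl
    _ = (r.lift i sq).app c b := by
      rw [yonedaEquiv_comp, Equiv.apply_symm_apply]

lemma rightMap_eq_of_lift {f : Arrow (Cᵒᵖ ⥤ Type u)}
    {l l' : ∀ (i : I) (_ : U.obj i ⟶ f), (U.obj i).right ⟶ f.left} (h : ∀ i sq, l i sq = l' i sq)
    {h₁ h₂ h₃ h₁' h₂' h₃'} :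
    RightMap.mk (u := U) f l h₁ h₂ h₃ = RightMap.mk (u := U) f l' h₁' h₂' h₃' := by
  obtain rfl : l = l' := funext₂ h
  rfl

instance : (RightMap.forget U).Faithful where
  map_injective h := RightMap.Hom.ext h

include D in
lemma isoOver_rightMap : IsoOver (SieveAlgCat.forget J) (RightMap.forget U) :=
  .of_obj D.toRightMap D.ofRightMap rfl rfl
    (fun f => congrArg (SieveAlgCat.mk f.arrow) (D.algOfRightMap_rightMapOfAlg f))
    fun r => rightMap_eq_of_lift (D.rightMapOfAlg_algOfRightMap_lift r)

end SieveDense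

end RightMaps

section SievesOf

variable (M : MorphismProperty (Cᵒᵖ ⥤ Type u)) [M.IsStableUnderBaseChange]

/-- The sieves whose inclusion into the representable presheaf is in `M`. -/
def sievesOf : StableSieves C where
  mem S := M S.functorInclusion
  pullback_mem g _ hS := M.of_isPullback (sievePullback_cartesian _ g) hS

variable {M}

lemma sievesOf_classifies (M1 : M ≤ MorphismProperty.monomorphisms _)
    {m : Arrow (Cᵒᵖ ⥤ Type u)} (hm : M m.hom) : (sievesOf M).Classifies m :=
  have : Mono m.hom := M1 _ hm
  ⟨this, fun b => M.of_isPullback (imageSieveSquare_cartesian m b) hm⟩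

/-- The category of all maps in `M` and pullback squares contains the inclusions of sieves. -/
def sieveDenseIncl (M1 : M ≤ MorphismProperty.monomorphisms _) :
    SieveDense (sievesOf M) (CartSubcategory.incl M) where
  classifies i := sievesOf_classifies M1 i.2
  cartesian σ := σ.hom.2
  full sq h := ⟨⟨⟨sq, h⟩⟩, rfl⟩
  obj {_ S} hS := ⟨⟨sieveArrow S⟩, hS⟩
  iso {_ S} _ := Iso.refl (sieveArrow S)

variable (M) in
/-- The object of the category of maps in `M` and pullback squares that corresponds to a sieve. -/
def sieveObj (p : Σ c : C, {S : Sieve c // (sievesOf M).mem S}) : CartSubcategory M :=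
  ⟨⟨sieveArrow p.2.1⟩, p.2.2⟩

/-- The small category of inclusions of sieves in `M` and pullback squares. -/
def sieveDenseSmall (M1 : M ≤ MorphismProperty.monomorphisms _) :
    SieveDense (sievesOf M) (inducedFunctor (sieveObj M) ⋙ CartSubcategory.incl M) where
  classifies i := sievesOf_classifies M1 i.2.2
  cartesian σ := σ.hom.hom.2
  full sq h := ⟨⟨⟨⟨sq, h⟩⟩⟩, rfl⟩
  obj {c S} hS := (⟨c, S, hS⟩ : Σ c : C, {S : Sieve c // (sievesOf M).mem S})
  iso {_ S} _ := Iso.refl (sieveArrow S)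

lemma algebraicallyFree_incl (M1 : M ≤ MorphismProperty.monomorphisms _) :
    (sievesOf M).awfs.AlgebraicallyFree (CartSubcategory.incl M) :=
  (sievesOf M).isoOver_sieveAlgCat.trans (sieveDenseIncl M1).isoOver_rightMap

lemma cofibrantlyGenerated_awfs (M1 : M ≤ MorphismProperty.monomorphisms _) :
    AWFS.CofibrantlyGenerated.{u} (sievesOf M).awfs :=
  ⟨InducedCategory (CartSubcategory M) (sieveObj M), inferInstance, _,
    (sievesOf M).isoOver_sieveAlgCat.trans (sieveDenseSmall M1).isoOver_rightMap⟩

end SievesOf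

/-! ### Fillers and coalgebras -/

section Fillers

variable {E : Type*} [Category* E] {i j f g : Arrow E}

/-- The map `h` is a diagonal filler of the commutative square `sq`. -/
structure IsFiller (sq : i ⟶ f) (h : i.right ⟶ f.left) : Prop where
  hom_comp : i.hom ≫ h = sq.left
  comp_hom : h ≫ f.hom = sq.right

lemma IsFiller.comp_left {sq : i ⟶ f} {h : i.right ⟶ f.left} (H : IsFiller sq h) (ψ : f ⟶ g) :
    IsFiller (sq ≫ ψ) (h ≫ ψ.left) where
  hom_comp := by rw [← Category.assoc, H.hom_comp, Arrow.comp_left]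
  comp_hom := by rw [Category.assoc, Arrow.w, ← Category.assoc, H.comp_hom, Arrow.comp_right]

lemma IsFiller.right_comp {sq : i ⟶ f} {h : i.right ⟶ f.left} (H : IsFiller sq h) (φ : j ⟶ i) :
    IsFiller (φ ≫ sq) (φ.right ≫ h) where
  hom_comp := by rw [← Category.assoc, ← Arrow.w φ, Category.assoc, H.hom_comp, Arrow.comp_left]
  comp_hom := by rw [Category.assoc, H.comp_hom, Arrow.comp_right]

/-- For a square `τ` from `i` to an invertible arrow `j` that is invertible on codomains, squares
out of `j` correspond to maps out of the codomain of `i`. The latter are the fillers of the squares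
obtained from the former by composition with `τ`. -/
@[simps]
def fillerEquiv (τ : i ⟶ j) [IsIso j.hom] [IsIso τ.right] (f : Arrow E) :
    (j ⟶ f) ≃ (i.right ⟶ f.left) where
  toFun sq := τ.right ≫ inv j.hom ≫ sq.left
  invFun h := Arrow.homMk (j.hom ≫ inv τ.right ≫ h) (inv τ.right ≫ h ≫ f.hom)
  left_inv sq := by ext <;> simp
  right_inv h := by simp

section FillerEquiv

variable (τ : i ⟶ j) [IsIso j.hom] [IsIso τ.right]

lemma isFiller_fillerEquiv_iff {sq : i ⟶ f} {s : j ⟶ f} :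
    IsFiller sq (fillerEquiv τ f s) ↔ τ ≫ s = sq := by
  have fac_left : i.hom ≫ fillerEquiv τ f s = (τ ≫ s).left := by simp [← Arrow.w_assoc]
  have fac_right : fillerEquiv τ f s ≫ f.hom = (τ ≫ s).right := by simp
  refine ⟨fun H => ?_, ?_⟩
  · ext
    · rw [← fac_left, H.hom_comp]
    · rw [← fac_right, H.comp_hom]
  · rintro rfl
    exact ⟨fac_left, fac_right⟩

lemma fillerEquiv_comp (s : j ⟶ f) (ψ : f ⟶ g) :
    fillerEquiv τ g (s ≫ ψ) = fillerEquiv τ f s ≫ ψ.left := by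
  simp

lemma right_comp_fillerEquiv {i' j' : Arrow E} (τ' : i' ⟶ j') [IsIso j'.hom] [IsIso τ'.right]
    {φ : i' ⟶ i} {ψ : j' ⟶ j} (w : φ ≫ τ = τ' ≫ ψ) (s : j ⟶ f) :
    φ.right ≫ fillerEquiv τ f s = fillerEquiv τ' f (ψ ≫ s) := by
  have w_right : φ.right ≫ τ.right = τ'.right ≫ ψ.right := congrArg CommaMorphism.right w
  have w_inv : ψ.right ≫ inv j.hom = inv j'.hom ≫ ψ.left := by
    rw [IsIso.comp_inv_eq, Category.assoc, Arrow.w, IsIso.inv_hom_id_assoc]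
  simp [reassoc_of% w_right, reassoc_of% w_inv]

end FillerEquiv

/-- The universal square from an arrow to an identity. -/
def toIdRight (i : Arrow E) : i ⟶ Arrow.mk (𝟙 i.right) :=
  Arrow.homMk i.hom (𝟙 i.right)

/-- The square between identities given by a map. -/
def idMap {A B : E} (b : A ⟶ B) : Arrow.mk (𝟙 A) ⟶ Arrow.mk (𝟙 B) :=
  Arrow.homMk b b

lemma comp_toIdRight (φ : i ⟶ j) : φ ≫ toIdRight j = toIdRight i ≫ idMap φ.right := by
  ext <;> simp [toIdRight, idMap]

instance (B : E) : IsIso (Arrow.mk (𝟙 B)).hom :=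
  inferInstanceAs (IsIso (𝟙 B))

instance (i : Arrow E) : IsIso (toIdRight i).right :=
  inferInstanceAs (IsIso (𝟙 i.right))

/-- A functor on arrows which sends the universal square from an arrow to an identity to such a
square again, up to isomorphism; so it determines the codomain of an arrow from its codomain. -/
class PreservesToIdRight (L : Arrow E ⥤ Arrow E) : Prop where
  isIso_hom (B : E) : IsIso (L.obj (Arrow.mk (𝟙 B))).hom
  isIso_right (i : Arrow E) : IsIso (L.map (toIdRight i)).right

attribute [instance] PreservesToIdRight.isIso_hom PreservesToIdRight.isIso_right

variable {L P : Arrow E ⥤ Arrow E} [PreservesToIdRight L] (adj : L ⊣ P)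

/-- Transposition of diagonal fillers, by transposing squares out of identities. -/
def transpose (i f : Arrow E) : ((L.obj i).right ⟶ f.left) ≃ (i.right ⟶ (P.obj f).left) :=
  (fillerEquiv (L.map (toIdRight i)) f).symm.trans
    ((adj.homEquiv _ _).trans (fillerEquiv (toIdRight i) (P.obj f)))

lemma transpose_fillerEquiv (s : L.obj (Arrow.mk (𝟙 i.right)) ⟶ f) :
    transpose adj i f (fillerEquiv (L.map (toIdRight i)) f s) =
      fillerEquiv (toIdRight i) (P.obj f) (adj.homEquiv _ _ s) := by
  simp only [transpose, Equiv.trans_apply, Equiv.symm_apply_apply]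

lemma isFiller_transpose_iff {sq : L.obj i ⟶ f} {h : (L.obj i).right ⟶ f.left} :
    IsFiller (adj.homEquiv i f sq) (transpose adj i f h) ↔ IsFiller sq h := by
  obtain ⟨s, rfl⟩ := (fillerEquiv (L.map (toIdRight i)) f).surjective h
  rw [transpose_fillerEquiv, isFiller_fillerEquiv_iff, isFiller_fillerEquiv_iff,
    ← adj.homEquiv_naturality_left, Equiv.apply_eq_iff_eq]

lemma transpose_comp_left (h : (L.obj i).right ⟶ f.left) (ψ : f ⟶ g) :
    transpose adj i g (h ≫ ψ.left) = transpose adj i f h ≫ (P.map ψ).left := by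
  obtain ⟨s, rfl⟩ := (fillerEquiv (L.map (toIdRight i)) f).surjective h
  rw [← fillerEquiv_comp, transpose_fillerEquiv, transpose_fillerEquiv, ← fillerEquiv_comp,
    adj.homEquiv_naturality_right]

lemma transpose_map_right_comp (φ : i ⟶ j) (h : (L.obj j).right ⟶ f.left) :
    transpose adj i f ((L.map φ).right ≫ h) = φ.right ≫ transpose adj j f h := by
  obtain ⟨s, rfl⟩ := (fillerEquiv (L.map (toIdRight j)) f).surjective h
  have w : L.map φ ≫ L.map (toIdRight j) = L.map (toIdRight i) ≫ L.map (idMap φ.right) := by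
    rw [← L.map_comp, comp_toIdRight, L.map_comp]
  rw [right_comp_fillerEquiv _ _ w, transpose_fillerEquiv, transpose_fillerEquiv,
    right_comp_fillerEquiv _ _ (comp_toIdRight φ), adj.homEquiv_naturality_left]

end Fillers

namespace AWFS

variable {E : Type u} [Category.{v} E] {W : AWFS E}

/-- The structure map of a coalgebra, on codomains. -/
def coalgebraMap (c : W.Cof) : c.obj.V.right ⟶ (W.fact.R.obj c.obj.V).left :=
  c.obj.str.right

lemma isFiller_coalgebraMap (c : W.Cof) :
    IsFiller (W.fact.unit.app c.obj.V) (coalgebraMap c) where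
  hom_comp := by
    have str_left : c.obj.str.left = 𝟙 _ :=
      (Category.comp_id _).symm.trans (congrArg CommaMorphism.left c.property)
    refine (Arrow.w c.obj.str).symm.trans ?_
    rw [str_left]
    exact Category.id_comp _
  comp_hom := congrArg CommaMorphism.right c.property

lemma coalgebraMap_naturality {c d : W.Cof} (φ : c ⟶ d) :
    coalgebraMap c ≫ (W.fact.R.map φ.hom.f).left = φ.hom.f.right ≫ coalgebraMap d :=
  congrArg CommaMorphism.right φ.hom.h

lemma exists_lift_cof {K : Type*} [Category* K] (H : K ⥤ Arrow E)
    (l : ∀ k, (H.obj k).right ⟶ (W.fact.R.obj (H.obj k)).left)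
    (isFiller_l : ∀ k, IsFiller (W.fact.unit.app (H.obj k)) (l k))
    (l_naturality : ∀ {k k' : K} (φ : k ⟶ k'),
      l k ≫ (W.fact.R.map (H.map φ)).left = (H.map φ).right ≫ l k') :
    ∃ F : K ⥤ W.Cof, F ⋙ W.cofForget = H :=
  ⟨{ obj := fun k =>
      ⟨{ V := H.obj k
         str := Arrow.homMk (f := H.obj k) (g := W.fact.L.obj (H.obj k)) (u := 𝟙 _) (v := l k)
          ((Category.id_comp _).trans (isFiller_l k).hom_comp.symm) }, by
        ext1
        · exact Category.comp_id _
        · exact (isFiller_l k).comp_hom⟩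
     map := fun φ => ObjectProperty.homMk
      { f := H.map φ
        h := by
          ext1
          · exact (Category.id_comp _).trans (Category.comp_id _).symm
          · exact l_naturality φ }
     map_id := fun k => by
      apply ObjectProperty.hom_ext
      apply Endofunctor.Coalgebra.Hom.ext
      exact H.map_id k
     map_comp := fun φ ψ => by
      apply ObjectProperty.hom_ext
      apply Endofunctor.Coalgebra.Hom.ext
      exact H.map_comp φ ψ }, rfl⟩

end AWFS

/-! ### Pullback squares of free extension structures -/

namespace free

variable {J : StableSieves C} {X Y X' Y' : Cᵒᵖ ⥤ Type u} {f : X ⟶ Y} {f' : X' ⟶ Y'} {a : X ⟶ X'}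
  {b : Y ⟶ Y'}

section Node

variable {c : C} {S S' : Sieve c} {y y' : Y.obj (op c)} {s : Family (proj J f) S y}
  {s' : Family (proj J f) S' y'} {hS : J.mem S} {hS' : J.mem S'} {hid : ¬ S (𝟙 c)}
  {hid' : ¬ S' (𝟙 c)}

lemma leaf_injective : Function.Injective ((leaf J f).app (op c)) :=
  fun _ _ h => Tree.leaf.inj (congrArg Subtype.val h)

lemma leaf_ne_node (x : X.obj (op c)) : (leaf J f).app (op c) x ≠ node hS hid s :=
  fun h => by injection congrArg Subtype.val h

lemma node_inj (h : node hS hid s = node hS' hid' s') :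
    S = S' ∧ ∀ {d : C} (g : d ⟶ c) (hg : S g) (hg' : S' g), s.val g hg = s'.val g hg' := by
  obtain ⟨rfl, -, eq_branches⟩ := Tree.node.inj (congrArg Subtype.val h)
  refine ⟨rfl, fun {d} g hg _ => Subtype.ext ?_⟩
  exact congrFun (congrFun (congrFun (eq_of_heq eq_branches) d) g) hg

lemma map_app_leaf (w : a ≫ f' = f ≫ b) (x : X.obj (op c)) :
    (map J a b w).app (op c) ((leaf J f).app (op c) x) = (leaf J f').app (op c) (a.app (op c) x) :=
  congrArg (fun k => k.app (op c) x) (leaf_map (J := J) a b w)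

lemma map_app_node (w : a ≫ f' = f ≫ b) :
    (map J a b w).app (op c) (node hS hid s) =
      node hS hid (s.pushforward _ b (map_isHom a b w).w) := by
  rw [← alg_extend_of_not_mem, (map_isHom a b w).app_extend, alg_extend_of_not_mem hS hid]

end Node

lemma eq_of_map_eq (h : IsPullback a f f' b) {c : C} {t t' : (free J f).obj (op c)}
    (eq_map : (map J a b h.w).app (op c) t = (map J a b h.w).app (op c) t')
    (eq_proj : (proj J f).app (op c) t = (proj J f).app (op c) t') : t = t' := by
  induction t using induction with
  | leaf x =>
    induction t' using induction with
    | leaf x' =>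
      rw [map_app_leaf, map_app_leaf] at eq_map
      have eq_leaf := ((isPullback_iff_elementwise.1 h).2 _).1 _ _ (leaf_injective eq_map) eq_proj
      exact congrArg _ eq_leaf
    | node =>
      rw [map_app_leaf, map_app_node] at eq_map
      exact (leaf_ne_node _ eq_map).elim
  | @node c S y hS hid s ih =>
    induction t' using induction with
    | leaf x' =>
      rw [map_app_leaf, map_app_node] at eq_map
      exact (leaf_ne_node _ eq_map.symm).elim
    | @node _ S' y' hS' hid' s' _ =>
      rw [map_app_node, map_app_node] at eq_map
      obtain ⟨rfl, eq_branches⟩ := node_inj eq_map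
      obtain rfl : y = y' := eq_proj
      congr 1
      ext d g hg
      refine ih g hg (eq_branches g hg hg) ?_
      rw [s.app_val, s'.app_val]

lemma exists_map_eq (h : IsPullback a f f' b) {c : C} (t' : (free J f').obj (op c))
    (y : Y.obj (op c)) (hy : (proj J f').app (op c) t' = b.app (op c) y) :
    ∃ t, (map J a b h.w).app (op c) t = t' ∧ (proj J f).app (op c) t = y := by
  induction t' using induction with
  | leaf x' =>
    obtain ⟨x, rfl, hx⟩ := ((isPullback_iff_elementwise.1 h).2 _).2 x' y hy
    exact ⟨(leaf J f).app _ x, map_app_leaf h.w x, hx⟩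
  | @node c S y' hS hid s' ih =>
    obtain rfl : y' = b.app (op c) y := hy
    choose v map_v proj_v using fun {d : C} (g : d ⟶ c) (hg : S g) =>
      ih g hg (Y.map g.op y) (by rw [s'.app_val, NatTrans.naturality_apply])
    let s : Family (proj J f) S y :=
      { val := v
        map_val := fun g hg k => eq_of_map_eq h
          (by rw [NatTrans.naturality_apply, map_v, map_v, s'.map_val])
          (by rw [NatTrans.naturality_apply, proj_v, proj_v]; simp)
        app_val := proj_v }
    refine ⟨node hS hid s, ?_, rfl⟩
    rw [map_app_node]
    congr 1
    ext d g hg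
    exact map_v g hg

lemma map_isPullback (h : IsPullback a f f' b) :
    IsPullback (map J a b h.w) (proj J f) (proj J f') b :=
  isPullback_iff_elementwise.2
    ⟨(map_isHom a b h.w).w, fun _ => ⟨fun _ _ => eq_of_map_eq h, exists_map_eq h⟩⟩

end free

/-- The empty family. -/
def Family.empty {X Y : Cᵒᵖ ⥤ Type u} (f : X ⟶ Y) {c : C} (y : Y.obj (op c)) :
    Family f (⊥ : Sieve c) y where
  val _ h := h.elim
  map_val _ h := h.elim
  app_val _ h := h.elim

namespace StableSieves

open free

variable {J : StableSieves C}

variable (J) in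
lemma cartesianSquares_le_inverseImage_awfs :
    cartesianSquares (Cᵒᵖ ⥤ Type u) ≤
      (cartesianSquares (Cᵒᵖ ⥤ Type u)).inverseImage J.awfs.fact.R :=
  fun _ _ _ hσ => map_isPullback hσ

lemma exists_bot_lift (bot_mem : ∀ c : C, J.mem (⊥ : Sieve c)) :
    ∃ F : (Cᵒᵖ ⥤ Type u) ⥤ J.awfs.Cof, F ⋙ J.awfs.cofForget = botFunctor (Cᵒᵖ ⥤ Type u) := by
  refine AWFS.exists_lift_cof _ (fun X =>
    { app := fun c => TypeCat.ofHom fun x =>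
        (alg J (initial.to X)).extend (bot_mem c.unop) (Family.empty _ x)
      naturality := fun c d g => by
        ext x
        refine Eq.trans ?_ ((alg J (initial.to X)).map_extend (bot_mem c.unop)
          (Family.empty (proj J (initial.to X)) x) g.unop).symm
        exact (alg J (initial.to X)).extend_congr rfl rfl fun g h => h.elim })
    (fun X => ⟨initialIsInitial.hom_ext _ _, ?_⟩) (fun {X X'} φ => ?_)
  · ext c x
    exact (alg J (initial.to X)).app_extend _ _
  · ext c x
    refine ((map_isHom _ _ (Arrow.w ((botFunctor _).map φ))).app_extend _ _).trans ?_
    exact (alg J (initial.to X')).extend_congr rfl rfl fun g h => h.elim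

end StableSieves

namespace RightMap

variable {E : Type u} [Category.{v} E] {K : Type u₁} [Category.{v₁} K] {U : K ⥤ Arrow E}

lemma isFiller_lift (r : RightMap U) (i : K) (sq : U.obj i ⟶ r.arrow) :
    IsFiller sq (r.lift i sq) :=
  ⟨r.fac_left i sq, r.fac_right i sq⟩

variable (U) in
/-- Restriction of right maps along a functor. -/
def restrict {K' : Type u₂} [Category.{v₂} K'] (H : K' ⥤ K) : RightMap U ⥤ RightMap (H ⋙ U) where
  obj r :=
    { arrow := r.arrow
      lift i sq := r.lift (H.obj i) sq
      fac_left i sq := r.fac_left (H.obj i) sq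
      fac_right i sq := r.fac_right (H.obj i) sq
      naturality σ sq := r.naturality (H.map σ) sq }
  map φ := ⟨φ.sq, fun i sq => φ.lift_comp (H.obj i) sq⟩

variable {L P : Arrow E ⥤ Arrow E} [PreservesToIdRight L] (adj : L ⊣ P)

lemma isFiller_transpose_lift (r : RightMap (U ⋙ L)) (i : K) (sq : U.obj i ⟶ P.obj r.arrow) :
    IsFiller sq (transpose adj (U.obj i) r.arrow (r.lift i ((adj.homEquiv _ _).symm sq))) := by
  simpa using (isFiller_transpose_iff adj).2 (r.isFiller_lift i ((adj.homEquiv _ _).symm sq))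

variable (U) in
/-- The action of a right adjoint on right maps, by transposition of diagonal fillers. -/
def ofRightMapComp : RightMap (U ⋙ L) ⥤ RightMap U where
  obj r :=
    { arrow := P.obj r.arrow
      lift i sq := transpose adj (U.obj i) r.arrow (r.lift i ((adj.homEquiv _ _).symm sq))
      fac_left i sq := (isFiller_transpose_lift adj r i sq).hom_comp
      fac_right i sq := (isFiller_transpose_lift adj r i sq).comp_hom
      naturality σ sq := by
        rw [adj.homEquiv_naturality_left_symm, ← transpose_map_right_comp]
        exact congrArg _ (r.naturality σ _) }
  map {r r'} φ := ⟨P.map φ.sq, fun i sq => by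
    change _ = transpose adj (U.obj i) r'.arrow (r'.lift i ((adj.homEquiv _ _).symm (sq ≫ _)))
    rw [adj.homEquiv_naturality_right_symm, ← φ.lift_comp, transpose_comp_left]⟩
  map_id r := Hom.ext (P.map_id r.arrow)
  map_comp φ ψ := Hom.ext (P.map_comp φ.sq ψ.sq)

include adj in
lemma exists_lift_rightAdjoint {L' : K ⥤ K} (hL' : L' ⋙ U = U ⋙ L) :
    ∃ P' : RightMap U ⥤ RightMap U, P' ⋙ forget U = forget U ⋙ P := by
  obtain ⟨H, hH⟩ : ∃ H : RightMap U ⥤ RightMap (U ⋙ L), H ⋙ forget (U ⋙ L) = forget U := by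
    rw [← hL']
    exact ⟨restrict U L', rfl⟩
  exact ⟨H ⋙ ofRightMapComp U adj, congrArg (· ⋙ P) hH⟩

end RightMap

section MonadLift

variable {A : Type u} [Category.{v} A] {T : Monad A} {L P : A ⥤ A} (adj : L ⊣ P)
  {P' : T.Algebra ⥤ T.Algebra} (e : P' ⋙ T.forget ≅ T.forget ⋙ P)

/-- The transpose of the unit of a monad `T`, for a right adjoint `P` that lifts to algebras. -/
def transposeUnit : 𝟭 A ⟶ L ⋙ T.free ⋙ P' ⋙ T.forget :=
  adj.unit ≫ Functor.whiskerLeft L (Functor.whiskerRight T.η P) ≫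
    Functor.whiskerLeft (L ⋙ T.free) e.inv

variable (T) in
/-- The structure maps of all algebras. -/
def algebraAction : T.forget ⋙ T.toFunctor ⟶ T.forget where
  app B := B.a
  naturality _ _ φ := φ.h

/-- The maps of algebras from free algebras which extend the transpose of the unit. -/
def freeToRightAdjoint : T.toFunctor ⟶ L ⋙ T.toFunctor ⋙ P :=
  Functor.whiskerRight (transposeUnit adj e) T.toFunctor ≫
    Functor.whiskerLeft (L ⋙ T.free ⋙ P') (algebraAction T) ≫
    Functor.whiskerLeft (L ⋙ T.free) e.hom

lemma unit_freeToRightAdjoint (X : A) :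
    T.η.app X ≫ (freeToRightAdjoint adj e).app X = adj.homEquiv _ _ (T.η.app (L.obj X)) := by
  let B := P'.obj (T.free.obj (L.obj X))
  let η' : X ⟶ B.A := (transposeUnit adj e).app X
  let p : B.A ⟶ P.obj (T.obj (L.obj X)) := e.hom.app (T.free.obj (L.obj X))
  calc T.η.app X ≫ T.map η' ≫ B.a ≫ p
    _ = η' ≫ T.η.app B.A ≫ B.a ≫ p := (T.η.naturality_assoc η' _).symm
    _ = η' ≫ p := by rw [B.unit_assoc]
    _ = adj.homEquiv _ _ (T.η.app (L.obj X)) := by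
      refine (Category.assoc _ _ _).trans (Eq.trans (congrArg _ ?_) (adj.homEquiv_unit _ _ _).symm)
      exact (Category.assoc _ _ _).trans
        ((congrArg _ (e.inv_hom_id_app _)).trans (Category.comp_id _))

end MonadLift

namespace AWFS

variable {E : Type u} [Category.{v} E] {W : AWFS E} {L P : Arrow E ⥤ Arrow E}
  [PreservesToIdRight L] (adj : L ⊣ P) {κ : ∀ i, W.fact.R.obj i ⟶ P.obj (W.fact.R.obj (L.obj i))}

variable (κ) in
/-- The transpose of the composite of a coalgebra structure map and of a map to `P`. -/
def transposeCoalgebraMap (c : W.Cof) :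
    (L.obj c.obj.V).right ⟶ (W.fact.R.obj (L.obj c.obj.V)).left :=
  (transpose adj c.obj.V (W.fact.R.obj (L.obj c.obj.V))).symm
    (coalgebraMap c ≫ (κ c.obj.V).left)

lemma isFiller_transposeCoalgebraMap
    (unit_κ : ∀ i, W.fact.unit.app i ≫ κ i = adj.homEquiv _ _ (W.fact.unit.app (L.obj i)))
    (c : W.Cof) :
    IsFiller (W.fact.unit.app (L.obj c.obj.V)) (transposeCoalgebraMap adj κ c) := by
  refine (isFiller_transpose_iff adj (f := W.fact.R.obj (L.obj c.obj.V))).1 ?_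
  rw [transposeCoalgebraMap, Equiv.apply_symm_apply]
  exact unit_κ c.obj.V ▸ (isFiller_coalgebraMap c).comp_left (κ c.obj.V)

lemma transposeCoalgebraMap_naturality
    (naturality_κ : ∀ {i j} (φ : i ⟶ j),
      W.fact.R.map φ ≫ κ j = κ i ≫ P.map (W.fact.R.map (L.map φ)))
    {c d : W.Cof} (φ : c ⟶ d) :
    transposeCoalgebraMap adj κ c ≫ (W.fact.R.map (L.map φ.hom.f)).left =
      (L.map φ.hom.f).right ≫ transposeCoalgebraMap adj κ d := by
  apply (transpose adj c.obj.V (W.fact.R.obj (L.obj d.obj.V))).injective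
  rw [transpose_comp_left, transpose_map_right_comp, transposeCoalgebraMap, transposeCoalgebraMap,
    Equiv.apply_symm_apply, Equiv.apply_symm_apply, Category.assoc, ← Arrow.comp_left,
    ← naturality_κ, Arrow.comp_left, reassoc_of% coalgebraMap_naturality φ]

include adj in
lemma exists_lift_cof_leftAdjoint {P' : W.TrivFib ⥤ W.TrivFib}
    (e : P' ⋙ W.trivFibForget ≅ W.trivFibForget ⋙ P) :
    ∃ L' : W.Cof ⥤ W.Cof, L' ⋙ W.cofForget = W.cofForget ⋙ L :=
  exists_lift_cof _ (transposeCoalgebraMap adj (freeToRightAdjoint adj e).app)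
    (isFiller_transposeCoalgebraMap adj (unit_freeToRightAdjoint adj e))
    (transposeCoalgebraMap_naturality adj fun φ => (freeToRightAdjoint adj e).naturality φ)

include adj in
lemma AlgebraicallyFree.exists_lift_cof {K : Type u₁} [Category.{v₁} K] {U : K ⥤ Arrow E}
    (hW : W.AlgebraicallyFree U) {K' : K ⥤ K} (hK' : K' ⋙ U = U ⋙ L) :
    ∃ L' : W.Cof ⥤ W.Cof, L' ⋙ W.cofForget = W.cofForget ⋙ L := by
  obtain ⟨F, G, -, hGF, hF⟩ := hW
  obtain ⟨P', hP'⟩ := RightMap.exists_lift_rightAdjoint adj hK'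
  have hG : G ⋙ W.trivFibForget = RightMap.forget U := by
    rw [← hF, ← Functor.assoc, hGF, Functor.id_comp]
  refine exists_lift_cof_leftAdjoint adj (P' := F ⋙ P' ⋙ G) (eqToIso ?_)
  rw [Functor.assoc, Functor.assoc, hG, hP', ← Functor.assoc, hF]

end AWFS

/-! ### Pullbacks of coalgebras -/

namespace AWFS

variable {E : Type u} [Category.{v} E] {W : AWFS E}
  (hR : cartesianSquares E ≤ (cartesianSquares E).inverseImage W.fact.R) {i j i' j' : Arrow E}

section PullbackFiller

variable {σ : i ⟶ j} (hσ : cartesianSquares E σ) {l : j.right ⟶ (W.fact.R.obj j).left}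
  (hl : IsFiller (W.fact.unit.app j) l)

/-- The pullback of a coalgebra structure map along a cartesian square, for an awfs whose right
functor preserves cartesian squares. -/
def pullbackFiller : i.right ⟶ (W.fact.R.obj i).left :=
  IsPullback.lift (hR σ hσ) (σ.right ≫ l) (𝟙 i.right)
    ((Category.assoc _ _ _).trans ((congrArg _ hl.comp_hom).trans
      ((Category.comp_id _).trans (Category.id_comp _).symm)))

lemma pullbackFiller_map_left :
    pullbackFiller hR hσ hl ≫ (W.fact.R.map σ).left = σ.right ≫ l :=
  IsPullback.lift_fst (hR σ hσ) _ _ _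

lemma pullbackFiller_hom : pullbackFiller hR hσ hl ≫ (W.fact.R.obj i).hom = 𝟙 i.right :=
  IsPullback.lift_snd (hR σ hσ) _ _ _

lemma isFiller_pullbackFiller : IsFiller (W.fact.unit.app i) (pullbackFiller hR hσ hl) where
  hom_comp := by
    refine IsPullback.hom_ext (hR σ hσ) ?_ ?_
    · rw [Category.assoc, pullbackFiller_map_left, ← Arrow.comp_left, ← W.fact.unit.naturality σ]
      exact (hl.right_comp σ).hom_comp
    · refine (Category.assoc _ _ _).trans ((congrArg (i.hom ≫ ·) ?_).trans
        (Arrow.w (W.fact.unit.app i)).symm)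
      exact pullbackFiller_hom hR hσ hl
  comp_hom := pullbackFiller_hom hR hσ hl

variable {σ' : i' ⟶ j'} (hσ' : cartesianSquares E σ') {l' : j'.right ⟶ (W.fact.R.obj j').left}
  (hl' : IsFiller (W.fact.unit.app j') l')

lemma pullbackFiller_naturality {φ : i ⟶ i'} {ψ : j ⟶ j'} (w : φ ≫ σ' = σ ≫ ψ)
    (l_naturality : l ≫ (W.fact.R.map ψ).left = ψ.right ≫ l') :
    pullbackFiller hR hσ hl ≫ (W.fact.R.map φ).left = φ.right ≫ pullbackFiller hR hσ' hl' := by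
  have w_right : φ.right ≫ σ'.right = σ.right ≫ ψ.right := congrArg CommaMorphism.right w
  refine IsPullback.hom_ext (hR σ' hσ') ?_ ?_
  · rw [Category.assoc, Category.assoc, pullbackFiller_map_left, ← Arrow.comp_left,
      ← W.fact.R.map_comp, w, W.fact.R.map_comp, Arrow.comp_left,
      reassoc_of% pullbackFiller_map_left, l_naturality, reassoc_of% w_right]
  · rw [Category.assoc, Category.assoc, Arrow.w, pullbackFiller_hom,
      reassoc_of% pullbackFiller_hom]
    exact (Category.id_comp φ.right).trans (Category.comp_id φ.right).symm

end PullbackFiller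

/-- The square from the pullback of an arrow to the arrow. -/
def pullbackSquare [HasPullbacks E] (k : Comma (𝟭 E) (Arrow.rightFunc : Arrow E ⥤ E)) :
    (pullbackFunctor E).obj k ⟶ k.right :=
  Arrow.homMk (pullback.fst _ _) k.hom pullback.condition

lemma pullbackSquare_cartesian [HasPullbacks E]
    (k : Comma (𝟭 E) (Arrow.rightFunc : Arrow E ⥤ E)) :
    cartesianSquares E (pullbackSquare k) :=
  IsPullback.of_hasPullback k.right.hom k.hom

lemma pullbackFunctor_map_comp_pullbackSquare [HasPullbacks E]
    {k k' : Comma (𝟭 E) (Arrow.rightFunc : Arrow E ⥤ E)} (φ : k ⟶ k') :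
    (pullbackFunctor E).map φ ≫ pullbackSquare k' = pullbackSquare k ≫ φ.right := by
  ext
  · exact pullback.lift_fst _ _ _
  · exact φ.w

include hR in
lemma exists_pullback_lift [HasPullbacks E] :
    ∃ F : CospanOver W.cofForget ⥤ W.Cof, F ⋙ W.cofForget =
      Comma.preRight (𝟭 E) W.cofForget Arrow.rightFunc ⋙ pullbackFunctor E := by
  let H := Comma.preRight (𝟭 E) W.cofForget Arrow.rightFunc
  refine exists_lift_cof (H ⋙ pullbackFunctor E)
    (fun k =>
      pullbackFiller hR (pullbackSquare_cartesian (H.obj k)) (isFiller_coalgebraMap k.right))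
    (fun k => isFiller_pullbackFiller hR _ _) fun {k k'} φ => ?_
  exact pullbackFiller_naturality hR _ _ _ _ (pullbackFunctor_map_comp_pullbackSquare (H.map φ))
    (coalgebraMap_naturality φ.right)

end AWFS

/-! ### Leibniz products -/

section Leibniz

variable {E : Type u} [Category.{v} E] [HasPushouts E] {F I : E ⥤ E} (d : F ⟶ I)

/-- The Leibniz product functor `d ⊗̂ (-)` with a natural transformation `d`. -/
abbrev leibniz : Arrow E ⥤ Arrow E :=
  (𝟭 (E ⥤ E)).leibnizPushout.obj (Arrow.mk d)

/-- The pushout that defines the Leibniz product of `d` and `i`. -/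
abbrev leibnizSquare (i : Arrow E) : (𝟭 (E ⥤ E)).PushoutObjObj d i.hom :=
  Functor.PushoutObjObj.ofHasPushout _ _ _

lemma isIso_leibniz_hom (i : Arrow E) [IsIso i.hom] : IsIso ((leibniz d).obj i).hom := by
  change IsIso (leibnizSquare d i).ι
  have isIso_map : IsIso (((𝟭 (E ⥤ E)).obj F).map i.hom) := inferInstance
  have isIso_inl : IsIso (leibnizSquare d i).inl := (leibnizSquare d i).isPushout.isIso_inl_of_isIso
  have isIso_comp : IsIso ((leibnizSquare d i).inl ≫ (leibnizSquare d i).ι) := by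
    rw [(leibnizSquare d i).inl_ι]
    exact inferInstanceAs (IsIso (I.map i.hom))
  exact IsIso.of_isIso_comp_left (leibnizSquare d i).inl _

instance : PreservesToIdRight (leibniz d) where
  isIso_hom B := isIso_leibniz_hom d (Arrow.mk (𝟙 B))
  isIso_right i := inferInstanceAs (IsIso (I.map (𝟙 i.right)))

end Leibniz

section LeibnizAdjunction

variable (E : Type u) [Category.{v} E]

/-- The category of those endofunctors of `E` which have a right adjoint. -/
abbrev LeftAdjointEndofunctor :=
  ObjectProperty.FullSubcategory (fun F : E ⥤ E => F.IsLeftAdjoint)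

variable {E} in
instance (F : LeftAdjointEndofunctor E) : F.obj.IsLeftAdjoint := F.property

/-- Right adjoints, contravariantly functorial in the left adjoint by mates. -/
def rightAdjoints : (LeftAdjointEndofunctor E)ᵒᵖ ⥤ E ⥤ E where
  obj F := F.unop.obj.rightAdjoint
  map d := conjugateEquiv (Adjunction.ofIsLeftAdjoint _) (Adjunction.ofIsLeftAdjoint _) d.unop.hom
  map_id _ := conjugateEquiv_id _
  map_comp _ _ := (conjugateEquiv_comp _ (Adjunction.ofIsLeftAdjoint _) _ _ _).symm

/-- The evaluation bifunctor and `rightAdjoints`, as a parametrized adjunction. -/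
def rightAdjointsParametrizedAdjunction :
    ObjectProperty.ι (fun F : E ⥤ E => F.IsLeftAdjoint) ⊣₂ rightAdjoints E where
  adj F := Adjunction.ofIsLeftAdjoint F.obj
  unit_whiskerRight_map d := by
    ext X
    exact (unit_conjugateEquiv _ _ d.hom X).symm

variable {E} in
lemma isLeftAdjoint_leibniz [HasPushouts E] [HasPullbacks E] {F I : E ⥤ E} (d : F ⟶ I)
    [hF : F.IsLeftAdjoint] [hI : I.IsLeftAdjoint] : (leibniz d).IsLeftAdjoint :=
  (Functor.LeibnizAdjunction.adj _ _ (rightAdjointsParametrizedAdjunction E)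
    (Arrow.mk (X := (⟨F, hF⟩ : LeftAdjointEndofunctor E)) (Y := ⟨I, hI⟩)
      (ObjectProperty.homMk d))).isLeftAdjoint

end LeibnizAdjunction

section LeibnizCartesian

variable {C : Type u} [SmallCategory C] {F I : (Cᵒᵖ ⥤ Type u) ⥤ Cᵒᵖ ⥤ Type u} (d : F ⟶ I)
  {i j : Arrow (Cᵒᵖ ⥤ Type u)}

lemma exists_inl_or_inr_leibnizSquare (i : Arrow (Cᵒᵖ ⥤ Type u)) {c : C}
    (x : ((leibniz d).obj i).left.obj (op c)) :
    (∃ a, (leibnizSquare d i).inl.app (op c) a = x) ∨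
      ∃ b, (leibnizSquare d i).inr.app (op c) b = x :=
  Types.eq_or_eq_of_isPushout
    ((leibnizSquare d i).isPushout.map ((evaluation _ _).obj (op c))) x

/-- The pullback of a union is the union of the pullbacks: the pullbacks of the two parts of the
Leibniz product are given by the assumptions on `I` and on `d`. -/
lemma cartesianSquares_leibniz_map [PreservesLimitsOfShape WalkingCospan I]
    (hd : NatTrans.Equifibered d) [Mono ((leibniz d).obj i).hom] {σ : i ⟶ j}
    (hσ : cartesianSquares _ σ) : cartesianSquares _ ((leibniz d).map σ) := by
  have mono_app (c : C) : Mono (((leibniz d).obj i).hom.app (op c)) := inferInstance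
  refine isPullback_iff_elementwise.2 ⟨Arrow.w ((leibniz d).map σ), fun c =>
    ⟨fun x y _ h => (mono_iff_injective _).1 (mono_app c) h, fun x y h => ?_⟩⟩
  have map_inl : (leibnizSquare d i).inl ≫ ((leibniz d).map σ).left =
      I.map σ.left ≫ (leibnizSquare d j).inl :=
    (leibnizSquare d i).isPushout.inl_desc _ _ _
  have map_inr : (leibnizSquare d i).inr ≫ ((leibniz d).map σ).left =
      F.map σ.right ≫ (leibnizSquare d j).inr :=
    (leibnizSquare d i).isPushout.inr_desc _ _ _
  obtain ⟨a, rfl⟩ | ⟨b, rfl⟩ := exists_inl_or_inr_leibnizSquare d j x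
  · have inl_ι := congrArg (fun t => t.app (op c) a) (leibnizSquare d j).inl_ι
    obtain ⟨z, rfl, rfl⟩ :=
      ((isPullback_iff_elementwise.1 (hσ.map I)).2 c).2 a y (inl_ι.symm.trans h)
    exact ⟨(leibnizSquare d i).inl.app (op c) z, congrArg (fun t => t.app (op c) z) map_inl,
      congrArg (fun t => t.app (op c) z) (leibnizSquare d i).inl_ι⟩
  · have inr_ι := congrArg (fun t => t.app (op c) b) (leibnizSquare d j).inr_ι
    obtain ⟨z, rfl, rfl⟩ :=
      ((isPullback_iff_elementwise.1 (hd σ.right)).2 c).2 b y (inr_ι.symm.trans h)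
    exact ⟨(leibnizSquare d i).inr.app (op c) z, congrArg (fun t => t.app (op c) z) map_inr,
      congrArg (fun t => t.app (op c) z) (leibnizSquare d i).inr_ι⟩

lemma exists_leibniz_lift_cartSubcategory [PreservesLimitsOfShape WalkingCospan I]
    (hd : NatTrans.Equifibered d) {M : MorphismProperty (Cᵒᵖ ⥤ Type u)}
    (M1 : M ≤ MorphismProperty.monomorphisms _)
    (M4 : ∀ i : Arrow (Cᵒᵖ ⥤ Type u), M i.hom → M ((leibniz d).obj i).hom) :
    ∃ F : CartSubcategory M ⥤ CartSubcategory M,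
      F ⋙ CartSubcategory.incl M = CartSubcategory.incl M ⋙ leibniz d :=
  ⟨{ obj := fun i => ⟨⟨(leibniz d).obj i.obj.obj⟩, M4 _ i.property⟩
     map := fun {i _} σ =>
      have : Mono ((leibniz d).obj i.obj.obj).hom := M1 _ (M4 _ i.property)
      ObjectProperty.homMk ⟨(leibniz d).map σ.hom.1, cartesianSquares_leibniz_map d hd σ.hom.2⟩
     map_id := fun i =>
      ObjectProperty.hom_ext _ (WideSubcategory.hom_ext _ ((leibniz d).map_id i.obj.obj))
     map_comp := fun σ τ =>
      ObjectProperty.hom_ext _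
        (WideSubcategory.hom_ext _ ((leibniz d).map_comp σ.hom.1 τ.hom.1)) }, rfl⟩

end LeibnizCartesian

section BotMem

variable {C : Type u} [SmallCategory C]

lemma imageSieve_initial_to {X : Cᵒᵖ ⥤ Type u} {c : C} (x : X.obj (op c)) :
    Presheaf.imageSieve (initial.to X) x = ⊥ := by
  ext d g
  refine ⟨fun ⟨a, _⟩ => ?_, fun h => h.elim⟩
  exact ((initial.to ((Functor.const Cᵒᵖ).obj PEmpty)).app (op d) a).elim

lemma bot_mem_sievesOf {M : MorphismProperty (Cᵒᵖ ⥤ Type u)} [M.IsStableUnderBaseChange]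
    (M1 : M ≤ MorphismProperty.monomorphisms _)
    (M2 : ∀ X : Cᵒᵖ ⥤ Type u, M (initial.to X)) (c : C) : (sievesOf M).mem (⊥ : Sieve c) := by
  rw [← imageSieve_initial_to (X := yoneda.obj c) (𝟙 c)]
  exact (sievesOf_classifies M1 (m := Arrow.mk (initial.to _)) (M2 _)).imageSieve_mem _

end BotMem

end UniformFibrations

end

open UniformFibrations in
theorem mainTheorem6_general {C : Type u} [SmallCategory C]
    (Cyl : FunctorialCylinder (Cᵒᵖ ⥤ Type u))
    (adj : Cyl.cyl.IsLeftAdjoint)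
    (C1 : PreservesLimitsOfShape WalkingCospan Cyl.cyl)
    (C2 : ∀ k : Fin 2, NatTrans.Equifibered (Cyl.δ k))
    (M : MorphismProperty (Cᵒᵖ ⥤ Type u))
    (M1 : M ≤ MorphismProperty.monomorphisms (Cᵒᵖ ⥤ Type u))
    (M2 : ∀ X : Cᵒᵖ ⥤ Type u, M (initial.to X))
    (M3 : M.IsStableUnderBaseChange)
    (M4 : ∀ (k : Fin 2) (i : Arrow (Cᵒᵖ ⥤ Type u)), M i.hom → M ((Cyl.leibniz k).obj i).hom) :
    ∃ W : AWFS (Cᵒᵖ ⥤ Type u),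
      AWFS.IsSuitable.{u} W Cyl ∧ W.AlgebraicallyFree (CartSubcategory.incl M) := by
  have free_incl : (sievesOf M).awfs.AlgebraicallyFree (CartSubcategory.incl M) :=
    algebraicallyFree_incl M1
  refine ⟨(sievesOf M).awfs,
    { cofibrantlyGenerated := cofibrantlyGenerated_awfs M1
      bot := StableSieves.exists_bot_lift (bot_mem_sievesOf M1 M2)
      pullback := AWFS.exists_pullback_lift (sievesOf M).cartesianSquares_le_inverseImage_awfs
      leibniz := fun k => ?_ }, free_incl⟩
  have : (leibniz (Cyl.δ k)).IsLeftAdjoint := isLeftAdjoint_leibniz (Cyl.δ k)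
  obtain ⟨_, hF⟩ := exists_leibniz_lift_cartSubcategory (Cyl.δ k) (C2 k) M1 (M4 k)
  exact free_incl.exists_lift_cof (L := leibniz (Cyl.δ k)) (Adjunction.ofIsLeftAdjoint _) hF

open UniformFibrations in
theorem mainTheorem6 {C : Type u} [SmallCategory C]
    (Cyl : FunctorialCylinder (Cᵒᵖ ⥤ Type u))
    (contr : Cyl.Contractions) (conn : FunctorialCylinder.Connections contr)
    (adj : Cyl.cyl.IsLeftAdjoint)
    (C1 : PreservesLimitsOfShape WalkingCospan Cyl.cyl)
    (C2 : ∀ k : Fin 2, NatTrans.Equifibered (Cyl.δ k))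
    (M : MorphismProperty (Cᵒᵖ ⥤ Type u))
    (M1 : M ≤ MorphismProperty.monomorphisms (Cᵒᵖ ⥤ Type u))
    (M2 : ∀ X : Cᵒᵖ ⥤ Type u, M (initial.to X))
    (M3 : M.IsStableUnderBaseChange)
    (M4 : ∀ (k : Fin 2) (i : Arrow (Cᵒᵖ ⥤ Type u)), M i.hom → M ((Cyl.leibniz k).obj i).hom) :
    ∃ W : AWFS (Cᵒᵖ ⥤ Type u),
      AWFS.IsSuitable.{u} W Cyl ∧ W.AlgebraicallyFree (CartSubcategory.incl M) :=
  mainTheorem6_general Cyl adj C1 C2 M M1 M2 M3 M4
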